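/- **Trees.** A ranked alphabet is a set $\Sigma$ with a rank map $\mathrm{rk}\colon\Sigma\to\mathbb N_0$; $T_\Sigma$ is the set of trees over $\Sigma$ and, for finite $\Sigma$, $\mathrm{mr}_\Sigma=\max_{\sigma}\mathrm{rk}(\sigma)$. $P_\Sigma(X_k)$ is the set of $k$-ary patterns: trees over $\Sigma\cup\{x_1,\dots,x_k\}$ (the variables having rank $0$) in which each $x_i$ occurs exactly once; such a pattern has rank $k$. A forest is a sequence of patterns. A $k$-ary pattern is *footed* if $k=0$, or if $k\ge1$ and some node, the *foot node*, has a label of rank $k$ in the alphabet and has children labelled $x_1,\dots,x_k$ in this order. A tree language $L$ is *root consistent* if $\mathrm{rk}(t_1(\varepsilon))\ne\mathrm{rk}(t_2(\varepsilon))$ for all $t_1,t_2\in L$ with distinct root labels $t_1(\varepsilon)\neq t_2(\varepsilon)$. **Grammars.** A *multiple context-free tree grammar* (MCFTG) is $G=(N,\mathcal N,\Sigma,S,R)$ with disjoint finite ranked alphabets $N$ (nonterminals) and $\Sigma$ (terminals), where $\mathrm{mr}_\Sigma\ge1$; a finite set $\mathcal N$ of big nonterminals, which are nonempty repetition-free sequences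 over $N$, distinct ones having distinct sets of elements; an initial nonterminal $S$ of rank $0$ with $(S)\in\mathcal N$; and a finite set $R$ of rules $A\to(u,\mathcal L)$ with $A=(A_1,\dots,A_n)\in\mathcal N$, $u=(u_1,\dots,u_n)$, $u_j\in P_{N\cup\Sigma}(X_{\mathrm{rk}(A_j)})$, where every nonterminal occurs at most once in $u$, and where $\mathcal L\subseteq\mathcal N$ is a set of links whose element sets partition the set of nonterminals occurring in $u$. For every rule an (arbitrary) linear order of its links is fixed. The forest languages $L(G,A)$, $A\in\mathcal N$, are the smallest sets such that for every rule $A\to(u,\mathcal L)$ and all forests $f(B)\in L(G,B)$, $B\in\mathcal L$, the forest $u[B\leftarrow f(B)\mid B\in\mathcal L]$ (second-order substitution) is in $L(G,A)$; and $L(G)=L(G,S)\subseteq T_\Sigma$. Put $\mu(G)=\max\{|A| : A\in\mathcal N\}$ and $\mathrm{wid}(G)=\max\{\mathrm{rk}(C): C\in N\}$. $G$ is *start-separated* if $S$ occurs in no right-hand side $u$. For $\Delta\subseteq\Sigma$, $G$ is *$\Delta$-lexicalized* if the right-hand side of every rule contains a symbol of $\Delta$, except possibly for rules that are both initial (left-hand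 side $S$) and terminal (no nonterminal in $u$). **MC-TAGs.** A *(strict set-local) MC-TAG* is an MCFTG in which all patterns $u_j$ in all right-hand sides are footed, and for which there is an equivalence relation $\equiv$ on $N\cup\Sigma$ such that (1) distinct equivalent terminals have distinct ranks; (2) every nonterminal is equivalent to some terminal; (3) for every rule $(A_1,\dots,A_n)\to((u_1,\dots,u_n),\mathcal L)$ and every $j$, the root label of $u_j$ is equivalent to $A_j$, and, if $\mathrm{rk}(A_j)\ge1$, the foot node label of $u_j$ is equivalent to $A_j$. **Equivalence.** View $R$ as a ranked alphabet in which a rule has as rank its number of links. $L(G_{\mathrm{der}})\subseteq T_R$ is the set of derivation trees: trees over $R$ whose root is labelled by a rule with left-hand side $S$ and in which the $i$-th child of a node labelled by a rule with (ordered) links $B_1,\dots,B_k$ is labelled by a rule with left-hand side $B_i$. The value of a derivation tree is given by $\mathrm{val}(\rho(d_1,\dots,d_k))=u[B_i\leftarrow \mathrm{val}(d_i)\mid 1\le i\le k]$ for $\rho=A\to(u,\{B_1,\dots,B_k\})$. An $\mathrm{LDT}^{\mathrm R}$-transduction is a partial function $T_\Omega\to T_{\Omega'}$ realized by a linear deterministic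 top-down tree transducer with regular look-ahead: it has finitely many states, an initial state, and finitely many rules $\langle q,\omega(y_1{:}L_1,\dots,y_k{:}L_k){:}L_0\rangle\to\zeta$ with regular tree languages $L_i\subseteq T_\Omega$ and with $\zeta$ a tree over $\Omega'$ with additional leaves $\langle q',y_i\rangle$, each $y_i$ occurring at most once in $\zeta$; distinct rules with the same $q,\omega$ have disjoint look-ahead $L_i\cap L_i'=\emptyset$ for some $0\le i\le k$; such a rule translates $\omega(s_1,\dots,s_k)\in L_0$ with $s_i\in L_i$ $(1\le i\le k)$ in state $q$ by replacing each leaf $\langle q',y_i\rangle$ of $\zeta$ by the translation of $s_i$ in state $q'$. MCFTGs $G$, $G'$ with the same terminal alphabet are *$\mathrm{LDT}^{\mathrm R}$-equivalent* if there are $\mathrm{LDT}^{\mathrm R}$-transductions $M\colon T_R\to T_{R'}$ and $M'\colon T_{R'}\to T_R$ such that $M(d)$ is defined, $M(d)\in L(G'_{\mathrm{der}})$ and $\mathrm{val}(M(d))=\mathrm{val}(d)$ for all $d\in L(G_{\mathrm{der}})$, and $M'(d')$ is defined, $M'(d')\in L(G_{\mathrm{der}})$ and $\mathrm{val}(M'(d'))=\mathrm{val}(d')$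 for all $d'\in L(G'_{\mathrm{der}})$. **Theorem.** For every MCFTG $G$ with terminal alphabet $\Sigma$ such that $L(G)$ is root consistent, there is a start-separated MC-TAG $G'$ that is $\mathrm{LDT}^{\mathrm R}$-equivalent to $G$ and satisfies $$\mu(G')\le\begin{cases}\mu(G)&\text{if }\mathrm{wid}(G)=0,\\ \mu(G)\cdot|\Sigma|\cdot\mathrm{mr}_\Sigma^2\cdot(2\,\mathrm{wid}(G)-1)&\text{if }\mathrm{wid}(G)\ge1.\end{cases}$$ Moreover, if $G$ is start-separated, then for every $\Delta\subseteq\Sigma$: if $G$ is $\Delta$-lexicalized, then so is $G'$. -/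

import Mathlib

namespace TreeGrammar

/-! ## Ranked trees, patterns, substitution -/

/-- Trees over the ranked alphabet `(α, rk)` with leaves labelled by variables from `V`
(each variable has rank 0). -/
inductive RTerm {α : Type*} (rk : α → ℕ) (V : Type*) where
  | var (x : V) : RTerm rk V
  | node (a : α) (ts : Fin (rk a) → RTerm rk V) : RTerm rk V

/-- `T_α`: trees without variables. -/
abbrev RTree {α : Type*} (rk : α → ℕ) := RTerm rk Empty

namespace RTerm

variable {α : Type*} {rk : α → ℕ} {V W : Type*}

/-- First-order substitution `t[f]`. -/
def bind (f : V → RTerm rk W) : RTerm rk V → RTerm rk W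
  | var x => f x
  | node a ts => node a fun i => bind f (ts i)

/-- The variable occurrences of a tree, from left to right. -/
def vars : RTerm rk V → List V
  | var x => [x]
  | node _ ts => (List.ofFn fun i => vars (ts i)).flatten

/-- The occurrences of symbols of the ranked alphabet in a tree, in pre-order. -/
def syms : RTerm rk V → List α
  | var _ => []
  | node a ts => a :: (List.ofFn fun i => syms (ts i)).flatten

/-- The symbol at the root (`none` if the root is a variable). -/
def root : RTerm rk V → Option α
  | var _ => none
  | node a _ => some a

/-- `Subterm s t`: `s` is the subtree of `t` at some position of `t`. -/
inductive Subterm : RTerm rk V → RTerm rk V → Prop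
  | refl (t : RTerm rk V) : Subterm t t
  | child {s : RTerm rk V} {a : α} {ts : Fin (rk a) → RTerm rk V} (i : Fin (rk a)) :
      Subterm s (ts i) → Subterm s (node a ts)

/-- `init(a) = a(x₁, …, x_k)` with `k = rk a`; the variable `x_{i+1}` is represented by `i : ℕ`. -/
def init (rk : α → ℕ) (a : α) : RTerm rk ℕ := node a fun i => var i.val

/-- `t` is a `k`-ary pattern: each of `x₁, …, x_k` occurs exactly once in `t`, and no other
variable occurs in `t`. -/
def IsPattern (k : ℕ) (t : RTerm rk ℕ) : Prop := t.vars.Perm (List.range k)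

/-- The `k`-ary pattern `t` (with `k ≥ 1`) has a foot node, and it is labelled `a`: some position
of `t` has label `a` of rank `k`, and its children are labelled `x₁, …, x_k` in this order. -/
def IsFootLabel (k : ℕ) (t : RTerm rk ℕ) (a : α) : Prop := rk a = k ∧ Subterm (init rk a) t

/-- Footed `k`-ary patterns. -/
def Footed (k : ℕ) (t : RTerm rk ℕ) : Prop := k = 0 ∨ ∃ a, IsFootLabel k t a

/-- Second-order substitution: every node labelled by a nonterminal `C` of rank `k` is replaced by
`f C`, with the `k` subtrees of the node substituted for `x₁, …, x_k`. -/
def subst {N T : Type*} {rkN : N → ℕ} {rkT : T → ℕ} (f : N → RTerm rkT ℕ) :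
    RTerm (Sum.elim rkN rkT) ℕ → RTerm rkT ℕ
  | var x => var x
  | node (Sum.inl C) ts =>
      (f C).bind fun i => if h : i < rkN C then subst f (ts ⟨i, h⟩) else var i
  | node (Sum.inr σ) ts => node σ fun i => subst f (ts i)

end RTerm

/-- A variable-free tree, viewed as a `0`-ary pattern. -/
def RTree.toPattern {α : Type*} {rk : α → ℕ} (t : RTree rk) : RTerm rk ℕ :=
  RTerm.bind (fun e : Empty => e.elim) t

/-- Root consistent tree languages. -/
def RootConsistent {T : Type*} {rk : T → ℕ} (L : Set (RTree rk)) : Prop :=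
  ∀ t₁ ∈ L, ∀ t₂ ∈ L, ∀ a₁ a₂ : T, t₁.root = some a₁ → t₂.root = some a₂ →
    a₁ ≠ a₂ → rk a₁ ≠ rk a₂

/-! ## Regular tree languages and `LDTᴿ`-transducers -/

/-- Regular tree grammars in normal form over a (finite) ranked alphabet;
`rules A a As` is the rule `A → a(As 0, …, As (k-1))`. -/
structure RTG {Ω : Type*} (rk : Ω → ℕ) where
  NT : Type
  finite_NT : Finite NT
  start : NT
  rules : NT → (a : Ω) → (Fin (rk a) → NT) → Prop

/-- `H.Gen A t`: the nonterminal `A` generates the tree `t`. -/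
inductive RTG.Gen {Ω : Type*} {rk : Ω → ℕ} (H : RTG rk) : H.NT → RTree rk → Prop
  | mk (A : H.NT) (a : Ω) (As : Fin (rk a) → H.NT) (ts : Fin (rk a) → RTree rk) :
      H.rules A a As → (∀ i, RTG.Gen H (As i) (ts i)) → RTG.Gen H A (RTerm.node a ts)

def RTG.language {Ω : Type*} {rk : Ω → ℕ} (H : RTG rk) : Set (RTree rk) :=
  {t | H.Gen H.start t}

def IsRegular {Ω : Type*} {rk : Ω → ℕ} (L : Set (RTree rk)) : Prop :=
  ∃ H : RTG rk, H.language = L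

/-- The data of a transducer rule `⟨q, ω(y₁ : L₁, …, y_k : L_k) : L₀⟩ → ζ` for fixed `q` and `ω`
with `k = rk ω`. The leaves `⟨q', y_i⟩` of `ζ` are represented by variables `(q', i)`. -/
structure LDTRRule (Q : Type) {Ω Δ : Type*} (rkΩ : Ω → ℕ) (rkΔ : Δ → ℕ) (k : ℕ) where
  look₀ : Set (RTree rkΩ)
  look : Fin k → Set (RTree rkΩ)
  rhs : RTerm rkΔ (Q × Fin k)

/-- Linear deterministic top-down tree transducers with regular look-ahead, between (finite)
ranked alphabets. -/
structure LDTR {Ω Δ : Type*} (rkΩ : Ω → ℕ) (rkΔ : Δ → ℕ) where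
  State : Type
  finite_State : Finite State
  init : State
  rules : State → (ω : Ω) → Set (LDTRRule State rkΩ rkΔ (rkΩ ω))
  finite_rules : ∀ q ω, (rules q ω).Finite
  regular₀ : ∀ q ω, ∀ r ∈ rules q ω, IsRegular r.look₀
  regular : ∀ q ω, ∀ r ∈ rules q ω, ∀ i, IsRegular (r.look i)
  linear : ∀ q ω, ∀ r ∈ rules q ω, (r.rhs.vars.map Prod.snd).Nodup
  deterministic : ∀ q ω, ∀ r ∈ rules q ω, ∀ r' ∈ rules q ω, r ≠ r' →
    Disjoint r.look₀ r'.look₀ ∨ ∃ i, Disjoint (r.look i) (r'.look i)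

/-- `M.Trans q s t`: the `q`-translation of `s` by `M` is defined and equal to `t`. -/
inductive LDTR.Trans {Ω Δ : Type*} {rkΩ : Ω → ℕ} {rkΔ : Δ → ℕ} (M : LDTR rkΩ rkΔ) :
    M.State → RTree rkΩ → RTree rkΔ → Prop
  | mk (q : M.State) (ω : Ω) (ss : Fin (rkΩ ω) → RTree rkΩ)
      (r : LDTRRule M.State rkΩ rkΔ (rkΩ ω)) (g : M.State × Fin (rkΩ ω) → RTree rkΔ) :
      r ∈ M.rules q ω → RTerm.node ω ss ∈ r.look₀ → (∀ i, ss i ∈ r.look i) →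
      (∀ x ∈ r.rhs.vars, LDTR.Trans M x.1 (ss x.2) (g x)) →
      LDTR.Trans M q (RTerm.node ω ss) (r.rhs.bind g)

/-- The partial function realized by `M`, as a relation: `M(s)` is defined and equal to `t`. -/
def LDTR.Realizes {Ω Δ : Type*} {rkΩ : Ω → ℕ} {rkΔ : Δ → ℕ} (M : LDTR rkΩ rkΔ)
    (s : RTree rkΩ) (t : RTree rkΔ) : Prop :=
  M.Trans M.init s t

/-! ## Multiple context-free tree grammars -/

/-- A rule `lhs → (rhs, links)`. The list `links` enumerates the set of links in the (arbitrary but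
fixed) linear order that is used for derivation trees. -/
structure Rule {N T : Type*} (rkN : N → ℕ) (rk : T → ℕ) where
  lhs : List N
  rhs : List (RTerm (Sum.elim rkN rk) ℕ)
  links : List (List N)

/-- The occurrences of nonterminals in a forest. -/
def nonterminals {N T : Type*} {rkN : N → ℕ} {rk : T → ℕ}
    (u : List (RTerm (Sum.elim rkN rk) ℕ)) : List N :=
  (u.flatMap RTerm.syms).filterMap Sum.getLeft?

/-- The occurrences of terminals in a forest. -/
def terminals {N T : Type*} {rkN : N → ℕ} {rk : T → ℕ}
    (u : List (RTerm (Sum.elim rkN rk) ℕ)) : List T :=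
  (u.flatMap RTerm.syms).filterMap Sum.getRight?

/-- Multiple context-free tree grammars with the (finite) terminal ranked alphabet `(T, rk)`. -/
structure MCFTG {T : Type*} (rk : T → ℕ) where
  /-- nonterminals -/
  NT : Type
  fintypeNT : Fintype NT
  rkN : NT → ℕ
  /-- big nonterminals -/
  big : Finset (List NT)
  big_ne_nil : ∀ A ∈ big, A ≠ []
  big_nodup : ∀ A ∈ big, A.Nodup
  big_inj : ∀ A ∈ big, ∀ B ∈ big, (∀ C, C ∈ A ↔ C ∈ B) → A = B
  exists_pos_rank : ∃ σ, 1 ≤ rk σ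
  start : NT
  start_mem : [start] ∈ big
  start_rank : rkN start = 0
  rules : Finset (Rule rkN rk)
  lhs_mem : ∀ ρ ∈ rules, ρ.lhs ∈ big
  /-- `rk(u) = rk(A)` for every rule `A → (u, 𝓛)` -/
  rhs_rank : ∀ ρ ∈ rules, List.Forall₂ (fun A u => u.IsPattern (rkN A)) ρ.lhs ρ.rhs
  /-- right-hand sides are uniquely `N`-labelled -/
  rhs_unique : ∀ ρ ∈ rules, (nonterminals ρ.rhs).Nodup
  links_mem : ∀ ρ ∈ rules, ∀ B ∈ ρ.links, B ∈ big
  /-- the links partition the set of nonterminals that occur in the right-hand side -/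
  links_nodup : ∀ ρ ∈ rules, ρ.links.flatten.Nodup
  mem_links : ∀ ρ ∈ rules, ∀ C, C ∈ ρ.links.flatten ↔ C ∈ nonterminals ρ.rhs
  /-- `links` represents a set: no two rules differ only in the order of the links -/
  links_order : ∀ ρ ∈ rules, ∀ ρ' ∈ rules, ρ.lhs = ρ'.lhs → ρ.rhs = ρ'.rhs →
    ρ.links.Perm ρ'.links → ρ = ρ'

namespace MCFTG

variable {T : Type*} {rk : T → ℕ} (G : MCFTG rk)

/-- `μ(G)`: the maximal length of the big nonterminals. -/
def multiplicity : ℕ := G.big.sup List.length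

/-- `wid(G)`: the maximal rank of the nonterminals. -/
def width : ℕ := (@Finset.univ G.NT G.fintypeNT).sup G.rkN

/-- Least fixed point semantics: `G.Gen A t` means that the forest `t` is in `L(G, A)`. The
substitution function on the links of a rule is given by its values `f C` on the nonterminals `C`
that occur in them. -/
inductive Gen : List G.NT → List (RTerm rk ℕ) → Prop
  | mk (ρ : Rule G.rkN rk) (f : G.NT → RTerm rk ℕ) : ρ ∈ G.rules →
      (∀ B ∈ ρ.links, Gen B (B.map f)) → Gen ρ.lhs (ρ.rhs.map (RTerm.subst f))

/-- The tree language `L(G)`. -/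
def treeLanguage : Set (RTree rk) := {t | G.Gen [G.start] [t.toPattern]}

/-! ### Derivation trees and their values -/

/-- The set of rules, a ranked alphabet in which the rank of a rule is its number of links. -/
abbrev R : Type _ := {ρ : Rule G.rkN rk // ρ ∈ G.rules}

/-- The rank of a rule. -/
abbrev ruleRank (ρ : G.R) : ℕ := ρ.1.links.length

/-- The derivation tree grammar `G_der`. -/
def derGrammar : RTG G.ruleRank where
  NT := {A : List G.NT // A ∈ G.big}
  finite_NT := inferInstance
  start := ⟨[G.start], G.start_mem⟩
  rules A ρ Bs := ρ.1.lhs = A.1 ∧ ∀ i, (Bs i).1 = ρ.1.links.get i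

open Classical in
/-- The function on nonterminals that assigns the `j`-th tree of the forest `vals i` to the `j`-th
element of the `i`-th link (and a dummy value to nonterminals not in the links). -/
noncomputable def linkSubst {N : Type*} (links : List (List N))
    (vals : Fin links.length → List (RTerm rk ℕ)) (C : N) : RTerm rk ℕ :=
  ((List.ofFn fun i => (links.get i).zip (vals i)).flatten.lookup C).getD (RTerm.var 0)

/-- The value `val(d)` of a derivation tree `d` all of whose labels are rules. -/
noncomputable def val : RTree G.ruleRank → List (RTerm rk ℕ)
  | RTerm.var e => e.elim
  | RTerm.node ρ ds =>
      ρ.1.rhs.map (RTerm.subst (linkSubst ρ.1.links fun i => val (ds i)))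

/-- `G` and `G'` are `LDTᴿ`-equivalent. -/
def LDTREquivalent (G G' : MCFTG rk) : Prop :=
  (∃ M : LDTR G.ruleRank G'.ruleRank, ∀ d ∈ G.derGrammar.language,
    ∃ d', M.Realizes d d' ∧ d' ∈ G'.derGrammar.language ∧ G'.val d' = G.val d) ∧
  (∃ M' : LDTR G'.ruleRank G.ruleRank, ∀ d' ∈ G'.derGrammar.language,
    ∃ d, M'.Realizes d' d ∧ d ∈ G.derGrammar.language ∧ G.val d = G'.val d')

/-! ### Start-separated, lexicalized and footed grammars, MC-TAGs -/

/-- The initial nonterminal does not occur in right-hand sides. -/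
def StartSeparated : Prop := ∀ ρ ∈ G.rules, G.start ∉ nonterminals ρ.rhs

/-- A rule is proper if it is not both initial and terminal. -/
def IsProper (ρ : Rule G.rkN rk) : Prop :=
  ¬ (ρ.lhs = [G.start] ∧ nonterminals ρ.rhs = [])

/-- `G` is `Δ`-lexicalized: some symbol of `Δ` occurs in the right-hand side of each proper rule. -/
def IsLexicalized (Δ : Set T) : Prop :=
  ∀ ρ ∈ G.rules, G.IsProper ρ → ∃ σ ∈ Δ, σ ∈ terminals ρ.rhs

/-- Footed grammars (nonstrict MC-TAGs). -/
def IsFooted : Prop :=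
  ∀ ρ ∈ G.rules, ∀ p ∈ ρ.lhs.zip ρ.rhs, p.2.Footed (G.rkN p.1)

/-- Strict set-local multi-component tree adjoining grammars. -/
def IsMCTAG : Prop :=
  G.IsFooted ∧ ∃ s : Setoid (G.NT ⊕ T),
    (∀ σ τ : T, σ ≠ τ → s.r (Sum.inr σ) (Sum.inr τ) → rk σ ≠ rk τ) ∧
    (∀ C : G.NT, ∃ σ : T, s.r (Sum.inl C) (Sum.inr σ)) ∧
    (∀ ρ ∈ G.rules, ∀ p ∈ ρ.lhs.zip ρ.rhs,
      (∃ a, p.2.root = some a ∧ s.r a (Sum.inl p.1)) ∧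
      (1 ≤ G.rkN p.1 → ∀ a, p.2.IsFootLabel (G.rkN p.1) a → s.r a (Sum.inl p.1)))

end MCFTG

end TreeGrammar

/-! A pattern generated by a nonterminal need not be footed, but it can be cut into footed pieces.
Give every terminal its own class. If a tree has variables, look for a smallest subtree that still
contains all of them and whose root has the class of the root of the tree. The context above its
children is a pattern whose root and foot have the same class; cut it off and continue with the
children. Variable-free subtrees stay whole. A class used while all variables stay together does not
return until the variables split, so the number of pieces is bounded in terms of the rank alone
(`exists_decomp`). The arrangement of the pieces, the shape, therefore ranges over a finite set.

The new grammar has one nonterminal for each piece of each old nonterminal, tagged with the big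
nonterminal and with its shapes. Given a rule and shapes for its links, replace each nonterminal of
the right-hand side by its shape with the piece names as node labels, and decompose the result
again. A fixed choice of decomposition makes the new shapes a function `next` of the rule and the
old shapes. Every derivation tree of `G` thus has well-defined shapes (`linkOfTree`), computed
bottom-up with finitely many values. Reassembling the pieces gives back the old value by
associativity of second-order substitution (`subst_tree_next`, `Interp.next`).

In one direction the transducer reads the shapes of the subtrees by regular look-ahead
(`isRegular_treesOf`). In the other it replaces each new rule by a rule from which it originates.
Links whose patterns are bare variables have no pieces and vanish from the new rule; fixed
derivation trees are put back for them.

Roots and feet of pieces agree in class, so equality of classes is almost the required equivalence.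
Only the new initial nonterminal must be equivalent to every root label of a tree in the language.
These labels are merged into one class, and root consistency says exactly that this is allowed. -/

namespace TreeGrammar

namespace RTerm

variable {α β : Type*} {rkα : α → ℕ} {rkβ : β → ℕ} {V W X : Type*}

/-! ## Position-dependent second-order substitution -/

/-- Second-order substitution in which the tree that replaces a node may depend on its position. -/
def psubst : RTerm rkβ ℕ → (List ℕ → β → RTerm rkα ℕ) → RTerm rkα ℕ
  | var x, _ => var x
  | node b ts, F => (F [] b).bind fun i =>
      if h : i < rkβ b then psubst (ts ⟨i, h⟩) (fun q => F (i :: q)) else var i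

/-- The positions of a tree with their labels, in pre-order. -/
def labels : RTerm rkβ V → List (List ℕ × β)
  | var _ => []
  | node b ts =>
      ([], b) :: (List.ofFn fun i => (labels (ts i)).map (Prod.map (List.cons i.val) id)).flatten

theorem bind_var (t : RTerm rkα V) : t.bind var = t := by
  induction t with
  | var x => rfl
  | node a ts ih => simp only [bind, ih]

theorem bind_bind (t : RTerm rkα V) (f : V → RTerm rkα W) (g : W → RTerm rkα X) :
    (t.bind f).bind g = t.bind fun x => (f x).bind g := by
  induction t with
  | var x => rfl
  | node a ts ih => simp only [bind, ih]

theorem bind_congr {t : RTerm rkα V} {f g : V → RTerm rkα W} (h : ∀ x ∈ t.vars, f x = g x) :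
    t.bind f = t.bind g := by
  induction t with
  | var x => exact h x (by simp [vars])
  | node a ts ih =>
    simp only [bind]
    congr 1
    funext i
    refine ih i fun x hx => h x ?_
    simp only [vars, List.mem_flatten, List.mem_ofFn]
    exact ⟨_, ⟨i, rfl⟩, hx⟩

theorem bind_eq_self {t : RTerm rkα V} {f : V → RTerm rkα V} (h : ∀ x ∈ t.vars, f x = var x) :
    t.bind f = t := by
  rw [bind_congr h, bind_var]

theorem vars_bind (t : RTerm rkα V) (f : V → RTerm rkα W) :
    (t.bind f).vars = t.vars.flatMap fun x => (f x).vars := by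
  induction t with
  | var x => simp [bind, vars]
  | node a ts ih =>
    simp only [bind, vars, ih, List.flatMap_def, List.map_flatten, List.map_ofFn,
      List.flatten_flatten, Function.comp_def]

theorem flatten_ofFn_append_perm {γ : Type*} : ∀ {n : ℕ} (f g : Fin n → List γ),
    (List.ofFn fun i => f i ++ g i).flatten.Perm
      ((List.ofFn f).flatten ++ (List.ofFn g).flatten)
  | 0, f, g => by simp
  | n + 1, f, g => by
    simp only [List.ofFn_succ, List.flatten_cons]
    have h := flatten_ofFn_append_perm (fun i => f i.succ) fun i => g i.succ
    refine (List.Perm.append_left _ h).trans ?_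
    simp only [List.append_assoc]
    refine List.Perm.append_left _ ?_
    simp only [← List.append_assoc]
    exact List.Perm.append_right _ List.perm_append_comm

theorem flatten_ofFn_perm {γ : Type*} : ∀ {n : ℕ} {f g : Fin n → List γ},
    (∀ i, (f i).Perm (g i)) → (List.ofFn f).flatten.Perm (List.ofFn g).flatten
  | 0, f, g, _ => by simp
  | n + 1, f, g, h => by
    simp only [List.ofFn_succ, List.flatten_cons]
    exact (h 0).append (flatten_ofFn_perm fun i => h i.succ)

theorem syms_bind (t : RTerm rkα V) (f : V → RTerm rkα W) :
    (t.bind f).syms.Perm (t.syms ++ t.vars.flatMap fun x => (f x).syms) := by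
  induction t with
  | var x => simp [bind, vars, syms]
  | node a ts ih =>
    simp only [bind, vars, syms, List.cons_append]
    refine List.Perm.cons _ ((flatten_ofFn_perm ih).trans
      ((flatten_ofFn_append_perm _ _).trans ?_))
    simp only [List.flatMap_def, List.map_flatten, List.map_ofFn,
      List.flatten_flatten, Function.comp_def, List.Perm.refl]

theorem flatMap_range_dite {γ : Type*} (n : ℕ) (f : (i : ℕ) → i < n → List γ) (g : ℕ → List γ) :
    ((List.range n).flatMap fun i => if h : i < n then f i h else g i) =
      (List.ofFn fun i : Fin n => f i i.2).flatten := by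
  rw [List.flatMap_def]
  congr 1
  refine List.ext_getElem (by simp) fun i h₁ h₂ => ?_
  have hi : i < n := by simpa using h₁
  simp [hi]

theorem labels_map_snd (t : RTerm rkβ V) : t.labels.map Prod.snd = t.syms := by
  induction t with
  | var x => rfl
  | node a ts ih =>
    simp only [labels, syms, List.map_cons, List.map_flatten, List.map_ofFn, Function.comp_def,
      List.map_map, Prod.map_snd, id, ← ih]

theorem labels_nodup (t : RTerm rkβ V) : t.labels.Nodup := by
  induction t with
  | var x => simp [labels]
  | node a ts ih =>
    simp only [labels, List.nodup_cons, List.nodup_flatten, List.mem_flatten, List.mem_ofFn]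
    refine ⟨?_, ?_, ?_⟩
    · rintro ⟨_, ⟨i, rfl⟩, h⟩
      simp [Prod.map] at h
    · rintro _ ⟨i, rfl⟩
      refine (ih i).map ?_
      rintro ⟨p, b⟩ ⟨q, c⟩ h
      simpa [Prod.map] using h
    · rw [List.pairwise_ofFn]
      intro i j hij x hx hy
      simp only [List.mem_map, Prod.exists, Prod.map] at hx hy
      obtain ⟨p, b, _, rfl⟩ := hx
      obtain ⟨q, c, _, h⟩ := hy
      simp only [Prod.mk.injEq, List.cons.injEq] at h
      exact hij.ne (Fin.ext h.1.1.symm)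

theorem mem_labels_node {b : β} {ts : Fin (rkβ b) → RTerm rkβ V} {ℓ : List ℕ × β} :
    ℓ ∈ (node b ts).labels ↔
      ℓ = ([], b) ∨ ∃ i : Fin (rkβ b), ∃ k ∈ (ts i).labels, ℓ = (i.val :: k.1, k.2) := by
  simp only [labels, List.mem_cons, List.mem_flatten, List.mem_ofFn, Prod.exists]
  constructor
  · rintro (h | ⟨_, ⟨i, rfl⟩, h⟩)
    · exact .inl h
    · simp only [List.mem_map, Prod.exists, Prod.map] at h
      obtain ⟨q, c, h, rfl⟩ := h
      exact .inr ⟨i, q, c, h, rfl⟩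
  · rintro (h | ⟨i, q, c, h, rfl⟩)
    · exact .inl h
    · exact .inr ⟨_, ⟨i, rfl⟩, List.mem_map.2 ⟨_, h, rfl⟩⟩

theorem psubst_congr {t : RTerm rkβ ℕ} : ∀ {F F' : List ℕ → β → RTerm rkα ℕ},
    (∀ ℓ ∈ t.labels, F ℓ.1 ℓ.2 = F' ℓ.1 ℓ.2) → t.psubst F = t.psubst F' := by
  induction t with
  | var x => intros; rfl
  | node b ts ih =>
    intro F F' h
    simp only [psubst]
    rw [h ([], b) (mem_labels_node.2 (.inl rfl))]
    congr 1
    funext i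
    split_ifs with hi
    · exact ih _ fun ℓ hℓ => h (i :: ℓ.1, ℓ.2) (mem_labels_node.2 (.inr ⟨⟨i, hi⟩, ℓ, hℓ, rfl⟩))
    · rfl

/-- A pattern uses each argument exactly once, so no subtree is copied or deleted; only the order of
the variables can change. The same reason gives the count of symbols in `syms_psubst`. -/
theorem vars_psubst {t : RTerm rkβ ℕ} : ∀ {F : List ℕ → β → RTerm rkα ℕ},
    (∀ ℓ ∈ t.labels, IsPattern (rkβ ℓ.2) (F ℓ.1 ℓ.2)) → (t.psubst F).vars.Perm t.vars := by
  induction t with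
  | var x => intros; exact .refl _
  | node b ts ih =>
    intro F h
    simp only [psubst, vars_bind]
    refine ((h ([], b) (mem_labels_node.2 (.inl rfl))).flatMap_right _).trans ?_
    simp only [apply_dite vars]
    rw [flatMap_range_dite]
    exact flatten_ofFn_perm fun i => ih i fun ℓ hℓ =>
      h (i :: ℓ.1, ℓ.2) (mem_labels_node.2 (.inr ⟨i, ℓ, hℓ, rfl⟩))

theorem syms_psubst {t : RTerm rkβ ℕ} : ∀ {F : List ℕ → β → RTerm rkα ℕ},
    (∀ ℓ ∈ t.labels, IsPattern (rkβ ℓ.2) (F ℓ.1 ℓ.2)) →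
      (t.psubst F).syms.Perm (t.labels.flatMap fun ℓ => (F ℓ.1 ℓ.2).syms) := by
  induction t with
  | var x => intros; exact .refl _
  | node b ts ih =>
    intro F h
    simp only [psubst, labels, List.flatMap_cons]
    refine (syms_bind _ _).trans (List.Perm.append_left _ ?_)
    refine ((h ([], b) (mem_labels_node.2 (.inl rfl))).flatMap_right _).trans ?_
    simp only [apply_dite syms]
    rw [flatMap_range_dite]
    refine (flatten_ofFn_perm fun i => ih i fun ℓ hℓ =>
      h (i :: ℓ.1, ℓ.2) (mem_labels_node.2 (.inr ⟨i, ℓ, hℓ, rfl⟩))).trans ?_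
    simp only [List.flatMap_def, List.map_flatten, List.map_ofFn,
      List.flatten_flatten, Function.comp_def, List.map_map, Prod.map, id, List.Perm.refl]

/-- Second-order substitution for arbitrary ranked alphabets. -/
abbrev gsubst (g : β → RTerm rkα ℕ) (t : RTerm rkβ ℕ) : RTerm rkα ℕ := t.psubst fun _ => g

theorem gsubst_congr {t : RTerm rkβ ℕ} {g g' : β → RTerm rkα ℕ}
    (h : ∀ b ∈ t.syms, g b = g' b) : gsubst g t = gsubst g' t :=
  psubst_congr fun ℓ hℓ => h _ (by rw [← labels_map_snd]; exact List.mem_map_of_mem hℓ)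

theorem mem_syms_node {b : β} {ts : Fin (rkβ b) → RTerm rkβ V} {c : β} :
    c ∈ (node b ts).syms ↔ c = b ∨ ∃ i, c ∈ (ts i).syms := by
  simp only [syms, List.mem_cons, List.mem_flatten, List.mem_ofFn]
  constructor
  · rintro (h | ⟨_, ⟨i, rfl⟩, h⟩)
    exacts [.inl h, .inr ⟨i, h⟩]
  · rintro (h | ⟨i, h⟩)
    exacts [.inl h, .inr ⟨_, ⟨i, rfl⟩, h⟩]

theorem mem_vars_node {b : β} {ts : Fin (rkβ b) → RTerm rkβ V} {x : V} :
    x ∈ (node b ts).vars ↔ ∃ i, x ∈ (ts i).vars := by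
  simp only [vars, List.mem_flatten, List.mem_ofFn]
  constructor
  · rintro ⟨_, ⟨i, rfl⟩, h⟩
    exact ⟨i, h⟩
  · rintro ⟨i, h⟩
    exact ⟨_, ⟨i, rfl⟩, h⟩

/-- The bound on variables is essential: a variable of `g b` beyond the rank of `b` is left free by
the substitution, and on the right it would be captured by `h`. -/
theorem gsubst_bind {t : RTerm rkβ ℕ} {g : β → RTerm rkα ℕ} (h : ℕ → RTerm rkβ ℕ)
    (hg : ∀ b ∈ t.syms, ∀ x ∈ (g b).vars, x < rkβ b) :
    gsubst g (t.bind h) = (gsubst g t).bind fun x => gsubst g (h x) := by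
  induction t with
  | var x => rfl
  | node b ts ih =>
    simp only [gsubst, bind, psubst] at ih ⊢
    rw [bind_bind]
    refine bind_congr fun i hi => ?_
    have hi' := hg b (mem_syms_node.2 (.inl rfl)) i hi
    simp only [hi', dif_pos]
    exact ih _ fun c hc => hg c (mem_syms_node.2 (.inr ⟨_, hc⟩))

/-- Associativity of second-order substitution, on which the correctness of the construction rests.
-/
theorem gsubst_psubst {γ : Type*} {rkγ : γ → ℕ} {D : RTerm rkγ ℕ} {g : β → RTerm rkα ℕ} :
    ∀ {F : List ℕ → γ → RTerm rkβ ℕ},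
    (∀ ℓ ∈ D.labels, ∀ b ∈ (F ℓ.1 ℓ.2).syms, ∀ x ∈ (g b).vars, x < rkβ b) →
    gsubst g (D.psubst F) = D.psubst fun q c => gsubst g (F q c) := by
  induction D with
  | var x => intros; rfl
  | node c ts ih =>
    intro F hF
    simp only [psubst]
    rw [gsubst_bind _ (hF ([], c) (mem_labels_node.2 (.inl rfl)))]
    congr 1
    funext i
    split_ifs with hi
    · exact ih _ fun ℓ hℓ =>
        hF (i :: ℓ.1, ℓ.2) (mem_labels_node.2 (.inr ⟨⟨i, hi⟩, ℓ, hℓ, rfl⟩))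
    · rfl

theorem init_bind (a : α) (f : ℕ → RTerm rkα ℕ) :
    (init rkα a).bind f = node a fun i => f i := rfl

theorem init_isPattern (a : α) : IsPattern (rkα a) (init rkα a) := by
  have h := flatMap_range_dite (rkα a) (fun i _ => [i]) fun i => [i]
  simp only [dite_eq_ite, ite_self, List.flatMap_singleton'] at h
  simp only [IsPattern, init, vars, h, List.Perm.refl]

/-- Terminals are regarded as replaced by themselves, so that the facts on `gsubst` apply to
grammars. -/
theorem subst_eq_gsubst {N T : Type*} {rkN : N → ℕ} {rk : T → ℕ} (f : N → RTerm rk ℕ)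
    (t : RTerm (Sum.elim rkN rk) ℕ) : subst f t = gsubst (Sum.elim f (init rk)) t := by
  induction t with
  | var x => rfl
  | node a ts ih =>
    rcases a with C | σ
    · simp only [subst, psubst, ih]
      rfl
    · have h : ∀ i : Fin (Sum.elim rkN rk (Sum.inr σ)), subst f (ts i) =
          if h : i.val < Sum.elim rkN rk (Sum.inr σ) then
            gsubst (Sum.elim f (init rk)) (ts ⟨i, h⟩) else var i.val := fun i => by
        rw [dif_pos i.2, ih]
      exact congrArg (node σ) (funext h)

theorem gsubst_init (g : β → RTerm rkα ℕ) (b : β) (hg : ∀ x ∈ (g b).vars, x < rkβ b) :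
    gsubst g (init rkβ b) = g b := by
  simp only [gsubst, init, psubst]
  exact bind_eq_self fun x hx => by rw [dif_pos (hg x hx)]

theorem root_bind {t : RTerm rkα V} {a : α} (h : t.root = some a) (f : V → RTerm rkα W) :
    (t.bind f).root = some a := by
  cases t with
  | var x => simp [root] at h
  | node a ts => exact h

theorem IsPattern.lt {k : ℕ} {t : RTerm rkα ℕ} (h : IsPattern k t) : ∀ x ∈ t.vars, x < k :=
  fun _ hx => List.mem_range.1 (h.mem_iff.1 hx)

theorem labels_length (t : RTerm rkβ V) : t.labels.length = t.syms.length := by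
  rw [← labels_map_snd, List.length_map]

end RTerm

end TreeGrammar

namespace TreeGrammar

namespace RTerm

variable {α : Type*} {rkα : α → ℕ} {V : Type*}

/-! ## Subtrees and foot nodes -/

theorem vars_sublist_node {a : α} (ts : Fin (rkα a) → RTerm rkα V) (i : Fin (rkα a)) :
    (ts i).vars.Sublist (node a ts).vars := by
  simp only [vars]
  exact List.sublist_flatten_of_mem (List.mem_ofFn.2 ⟨i, rfl⟩)

theorem Subterm.vars_sublist {s t : RTerm rkα V} (h : Subterm s t) : s.vars.Sublist t.vars := by
  induction h with
  | refl => exact .refl _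
  | child i _ ih => exact ih.trans (vars_sublist_node _ i)

theorem Subterm.trans {s t u : RTerm rkα V} (h : Subterm s t) (h' : Subterm t u) :
    Subterm s u := by
  induction h' with
  | refl => exact h
  | child i _ ih => exact .child i ih

theorem Subterm.eq_of_node {s : RTerm rkα V} {a : α} {ts : Fin (rkα a) → RTerm rkα V}
    (h : Subterm s (node a ts)) : s = node a ts ∨ ∃ i, Subterm s (ts i) := by
  cases h with
  | refl => exact .inl rfl
  | child i h => exact .inr ⟨i, h⟩

theorem not_mem_vars_of_ne {a : α} {ts : Fin (rkα a) → RTerm rkα V} {i j : Fin (rkα a)}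
    (hn : (node a ts).vars.Nodup) (hij : i ≠ j) {x : V} (hi : x ∈ (ts i).vars) :
    x ∉ (ts j).vars := by
  intro hj
  simp only [vars] at hn
  have hp := (List.nodup_flatten.1 hn).2
  rw [List.pairwise_ofFn] at hp
  rcases lt_or_gt_of_ne hij with h | h
  · exact hp h hi hj
  · exact hp h hj hi

theorem not_subterm_init_var {a : α} {x : ℕ} : ¬ Subterm (init rkα a) (var x : RTerm rkα ℕ) := by
  intro h
  cases h

/-- Both foot nodes have the first variable as a child, and it occurs only once; hence they cannot
lie in different branches, nor one below the other. -/
theorem subterm_init_unique {t : RTerm rkα ℕ} {a b : α} (hn : t.vars.Nodup)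
    (ha : 1 ≤ rkα a) (hb : 1 ≤ rkα b)
    (h : Subterm (init rkα a) t) (h' : Subterm (init rkα b) t) : a = b := by
  have h0 : ∀ {c : α}, 1 ≤ rkα c → 0 ∈ (init rkα c).vars := fun {c} hc =>
    (init_isPattern c).mem_iff.2 (List.mem_range.2 hc)
  induction t with
  | var x => exact (not_subterm_init_var h).elim
  | node c ts ih =>
    rcases h.eq_of_node with e | ⟨i, hi⟩
    · rcases h'.eq_of_node with e' | ⟨j, hj⟩
      · have := congrArg root (e.trans e'.symm)
        simpa [init, root] using this
      · obtain ⟨rfl, e⟩ := node.inj e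
        rw [← eq_of_heq e] at hj
        exact (not_subterm_init_var hj).elim
    · rcases h'.eq_of_node with e' | ⟨j, hj⟩
      · obtain ⟨rfl, e⟩ := node.inj e'
        rw [← eq_of_heq e] at hi
        exact (not_subterm_init_var hi).elim
      · by_cases hij : i = j
        · subst hij
          exact ih i (hn.sublist (vars_sublist_node ts i)) hi hj
        · exact (not_mem_vars_of_ne hn hij (hi.vars_sublist.subset (h0 ha))
            (hj.vars_sublist.subset (h0 hb))).elim

theorem IsFootLabel.unique {k : ℕ} {t : RTerm rkα ℕ} {a b : α} (ht : IsPattern k t) (hk : 1 ≤ k)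
    (ha : IsFootLabel k t a) (hb : IsFootLabel k t b) : a = b :=
  subterm_init_unique (ht.nodup_iff.2 List.nodup_range) (ha.1 ▸ hk) (hb.1 ▸ hk) ha.2 hb.2

/-- The tree obtained by cutting `t` below a node that dominates all variables of `t`. -/
theorem exists_context {t : RTerm rkα ℕ} {b : α} {us : Fin (rkα b) → RTerm rkα ℕ}
    (h : Subterm (node b us) t) (hv : (node b us).vars = t.vars) (hne : t.vars ≠ [])
    (hn : t.vars.Nodup) :
    ∃ w : RTerm rkα ℕ, IsPattern (rkα b) w ∧ Subterm (init rkα b) w ∧ w.root = t.root ∧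
      w.bind (fun i => if h : i < rkα b then us ⟨i, h⟩ else var i) = t := by
  generalize hs : node b us = s at h hv
  induction h with
  | refl =>
    subst hs
    refine ⟨init rkα b, init_isPattern b, .refl _, rfl, ?_⟩
    rw [init_bind]
    congr 1
    funext i
    simp
  | @child a ts i h ih =>
    have h₁ : s.vars.Sublist (ts i).vars := h.vars_sublist
    have h₂ : (ts i).vars.Sublist (node a ts).vars := vars_sublist_node ts i
    have h₃ : (ts i).vars = (node a ts).vars := h₂.eq_of_length_le (hv ▸ h₁.length_le)
    obtain ⟨w, hw, hsub, -, hb⟩ := ih (h₃ ▸ hne) (h₃ ▸ hn) (hv.trans h₃.symm)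
    have hj : ∀ j, j ≠ i → (ts j).vars = [] := fun j hj => by
      refine List.eq_nil_iff_forall_not_mem.2 fun x hx => ?_
      exact not_mem_vars_of_ne hn hj hx (h₃ ▸ (vars_sublist_node ts j).subset hx)
    have hbind : (node a (Function.update ts i w)).bind
        (fun i => if h : i < rkα b then us ⟨i, h⟩ else var i) = node a ts := by
      simp only [bind]
      congr 1
      funext j
      by_cases hji : j = i
      · subst hji
        simpa using hb
      · simp only [Function.update_of_ne hji]
        exact bind_eq_self fun x hx => by simp [hj j hji] at hx
    refine ⟨node a (Function.update ts i w), ?_, .child i (by simpa using hsub), rfl, hbind⟩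
    have hvars : (node a (Function.update ts i w)).vars = w.vars := by
      simp only [vars]
      have : (fun k => (Function.update ts i w k).vars) =
          fun k => if k = i then w.vars else [] := by
        funext k
        by_cases hk : k = i
        · subst hk; simp
        · simp [hk, hj k hk]
      rw [this]
      clear * -
      generalize w.vars = l
      generalize rkα a = m at i
      induction m with
      | zero => exact i.elim0
      | succ m ih =>
        rw [List.ofFn_succ, List.flatten_cons]
        refine Fin.cases ?_ (fun j => ?_) i
        · simp [Fin.succ_ne_zero]
        · simp only [Fin.succ_inj, ih j]
          simp [(Fin.succ_ne_zero j).symm]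
    rw [IsPattern, hvars]
    exact hw

/-- The number of nodes of a tree. -/
def size : RTerm rkα V → ℕ
  | var _ => 0
  | node _ ts => 1 + ∑ i, size (ts i)

theorem size_lt_node {a : α} (ts : Fin (rkα a) → RTerm rkα V) (i : Fin (rkα a)) :
    (ts i).size < (node a ts).size := by
  simp only [size]
  have := Finset.single_le_sum (f := fun i => (ts i).size) (fun _ _ => Nat.zero_le _)
    (Finset.mem_univ i)
  omega

theorem Subterm.size_le {s t : RTerm rkα V} (h : Subterm s t) : s.size ≤ t.size := by
  induction h with
  | refl => exact le_rfl
  | child i _ ih => exact ih.trans (size_lt_node _ i).le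

/-! ## Decomposition of trees into footed patterns -/

/-- The rank of a label of a shape: a footed pattern with root and foot of class `b.1`, or a
variable-free tree with root of class `b.1`. -/
def shapeRank {n : ℕ} (cr : Fin n → ℕ) (b : Fin n × Bool) : ℕ := if b.2 then cr b.1 else 0

variable {n : ℕ} (cl : α → Fin n) (cr : Fin n → ℕ)

/-- A pattern that may be represented by the label `b` of a shape. -/
structure IsPiece (b : Fin n × Bool) (w : RTerm rkα ℕ) : Prop where
  isPattern : IsPattern (shapeRank cr b) w
  root : ∃ a, w.root = some a ∧ cl a = b.1
  foot : shapeRank cr b = 0 ∨ ∃ a, IsFootLabel (shapeRank cr b) w a ∧ cl a = b.1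

/-- `t` is decomposed into the pieces `F` that are arranged according to the shape `D`. -/
structure IsDecomp (t : RTerm rkα ℕ) (D : RTerm (shapeRank cr) ℕ)
    (F : List ℕ → Fin n × Bool → RTerm rkα ℕ) : Prop where
  psubst_eq : D.psubst F = t
  isPiece : ∀ ℓ ∈ D.labels, IsPiece cl cr ℓ.2 (F ℓ.1 ℓ.2)

open Classical in
/-- The classes of the nodes that dominate all variables. -/
noncomputable def mainClasses (t : RTerm rkα ℕ) : Finset (Fin n) :=
  Finset.univ.filter fun c => ∃ b us, Subterm (node b us) t ∧ (node b us).vars = t.vars ∧ cl b = c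

theorem mem_mainClasses {t : RTerm rkα ℕ} {c : Fin n} : c ∈ mainClasses cl t ↔
    ∃ b us, Subterm (node b us) t ∧ (node b us).vars = t.vars ∧ cl b = c := by
  simp [mainClasses]

/-- The bound on the number of pieces of a tree with `k` variables, `c` classes of nodes dominating
all variables, `n` classes, and ranks at most `m`. -/
def pieceBound (m n c k : ℕ) : ℕ := if k = 0 then 1 else m * c + m * n * (2 * k - 2)

/-- The case in which the `k` variables split among the `r` children of the foot. A child with
variables may use all `n` classes afresh; since at least two children have variables, the factor `2
* k - 2` pays for this. -/
theorem sum_pieceBound_le {m n k r : ℕ} (b : Fin r → ℕ) (ks : Fin r → ℕ) (hr : r ≤ m) (hk : k ≠ 0)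
    (hsum : ∑ i, ks i = k) (hlt : ∀ i, ks i < k)
    (hb : ∀ i, b i ≤ pieceBound m n n (ks i)) :
    1 + ∑ i, b i ≤ m + m * n * (2 * k - 2) := by
  -- A child with variables stays `m * n` below the linear bound `2 * m * n * ks i`; two such gains
  -- provide the `-2` in the final factor.
  have h₁ : ∀ i, b i + (if ks i = 0 then 0 else m * n + 1) ≤ 1 + 2 * (m * n) * ks i := by
    intro i
    have := hb i
    unfold pieceBound at this
    split_ifs at this ⊢ with h
    · omega
    · obtain ⟨q, hq⟩ : ∃ q, ks i = q + 1 := ⟨ks i - 1, by omega⟩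
      rw [hq] at this ⊢
      have e : 2 * (q + 1) - 2 = 2 * q := by omega
      rw [e] at this
      nlinarith
  have hne : ∃ i, ks i ≠ 0 := by
    by_contra! h
    exact hk (by simpa [h] using hsum.symm)
  obtain ⟨i, hi⟩ := hne
  have hne' : ∃ j, j ≠ i ∧ ks j ≠ 0 := by
    by_contra! h
    have := Finset.sum_eq_single_of_mem (f := ks) i (Finset.mem_univ i) fun j _ hj => h j hj
    have := hlt i
    omega
  obtain ⟨j, hji, hj⟩ := hne'
  have h₂ := Finset.sum_le_sum fun i (_ : i ∈ Finset.univ) => h₁ i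
  rw [Finset.sum_add_distrib, Finset.sum_add_distrib, ← Finset.mul_sum, hsum] at h₂
  have h₃ : ∑ l ∈ ({i, j} : Finset (Fin r)), (if ks l = 0 then 0 else m * n + 1) ≤
      ∑ l, if ks l = 0 then 0 else m * n + 1 :=
    Finset.sum_le_sum_of_subset (Finset.subset_univ _)
  rw [Finset.sum_pair hji.symm, if_neg hi, if_neg hj] at h₃
  simp only [Finset.sum_const, Finset.card_univ, Fintype.card_fin, smul_eq_mul, mul_one] at h₂
  obtain ⟨q, rfl⟩ : ∃ q, k = q + 1 := ⟨k - 1, by have := hlt i; omega⟩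
  have e : 2 * (q + 1) - 2 = 2 * q := by omega
  rw [e]
  nlinarith

/-- The tree is cut at a smallest subtree that keeps all variables and the root class. If one child
of the cut node still has all variables, minimality removes the root class from its main classes,
and the other children cost one piece each. Otherwise the variables split and `sum_pieceBound_le`
applies. Recursion reaches far below the root, hence the induction on size. -/
theorem exists_decomp {m : ℕ} (hcr : ∀ i, cr i ≤ m)
    (hcl : ∀ a, rkα a = 0 ∨ rkα a = cr (cl a)) :
    ∀ t : RTerm rkα ℕ, t.vars.Nodup → ∃ D F, IsDecomp cl cr t D F ∧
      D.syms.length ≤ pieceBound m n (mainClasses cl t).card t.vars.length := by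
  intro t
  induction hN : t.size using Nat.strong_induction_on generalizing t with
  | _ N IH =>
  intro hn
  rcases t with x | ⟨a, ts⟩
  · exact ⟨var x, fun _ _ => var 0, ⟨rfl, by simp [labels]⟩, by simp [syms]⟩
  by_cases hv : (node a ts).vars = []
  · refine ⟨node (cl a, false) fun i => i.elim0, fun _ _ => node a ts, ⟨?_, ?_⟩, ?_⟩
    · simp only [psubst]
      exact bind_eq_self fun x hx => by simp [hv] at hx
    · intro ℓ hℓ
      rcases mem_labels_node.1 hℓ with rfl | ⟨i, -⟩
      · exact ⟨by simp [shapeRank, IsPattern, hv], ⟨a, rfl, rfl⟩, .inl rfl⟩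
      · exact i.elim0
    · simp [syms, hv, pieceBound, shapeRank]
  · -- a smallest subtree that contains all variables and has a root of the class of `a`
    obtain ⟨b, us, hsub, hvars, hcb, hmin⟩ : ∃ b us, Subterm (node b us) (node a ts) ∧
        (node b us).vars = (node a ts).vars ∧ cl b = cl a ∧
        ∀ b' us', Subterm (node b' us') (node a ts) → (node b' us').vars = (node a ts).vars →
          cl b' = cl a → (node b us).size ≤ (node b' us').size := by
      obtain ⟨u, ⟨⟨b, us, rfl, h₁, h₂, h₃⟩, hmin⟩⟩ := exists_minimalFor_of_wellFoundedLT
        (fun u : RTerm rkα ℕ => ∃ b us, u = node b us ∧ Subterm (node b us) (node a ts) ∧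
          (node b us).vars = (node a ts).vars ∧ cl b = cl a) size
          ⟨node a ts, a, ts, rfl, .refl _, rfl, rfl⟩
      refine ⟨b, us, h₁, h₂, h₃, fun b' us' h₁' h₂' h₃' => ?_⟩
      by_contra! hlt
      exact absurd (hmin ⟨b', us', rfl, h₁', h₂', h₃'⟩ hlt.le) (by simpa using hlt)
    obtain ⟨w, hwp, hwf, hwr, hwb⟩ := exists_context hsub hvars hv hn
    have hbn : (node b us).vars.Nodup := hvars ▸ hn
    -- A node above variables has children, so the alternative of rank 0 is excluded.
    have hrb : rkα b = cr (cl a) := by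
      rcases hcl b with h | h
      · refine (hv ?_).elim
        rw [← hvars]
        simp only [vars]
        rw [List.flatten_eq_nil_iff]
        simp only [List.mem_ofFn]
        rintro _ ⟨i, rfl⟩
        exact (Nat.not_lt_zero i.1 (h ▸ i.2)).elim
      · rw [h, hcb]
    have IH' : ∀ i, ∃ D F, IsDecomp cl cr (us i) D F ∧
        D.syms.length ≤ pieceBound m n (mainClasses cl (us i)).card (us i).vars.length :=
      fun i => IH _ (hN ▸ (size_lt_node us i).trans_le hsub.size_le) (us i) rfl
        (hbn.sublist (vars_sublist_node us i))
    choose Ds Fs hD hlen using IH'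
    have hrk : shapeRank cr (cl a, true) = rkα b := by simp [shapeRank, hrb]
    -- The context above the cut is the piece at the root of the shape; position `i :: q` belongs to
    -- the decomposition of the `i`-th child of the foot.
    refine ⟨node (cl a, true) fun i => Ds (Fin.cast hrk i), fun q c => match q with
      | [] => w
      | i :: q => if h : i < rkα b then Fs ⟨i, h⟩ q c else var i, ⟨?_, ?_⟩, ?_⟩
    · simp only [psubst]
      rw [← hwb]
      congr 1
      funext i
      by_cases hi : i < rkα b
      · rw [dif_pos hi, dif_pos (hrk ▸ hi), ← (hD ⟨i, hi⟩).psubst_eq]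
        simp only [hi, dif_pos]
        rfl
      · rw [dif_neg hi, dif_neg (hrk ▸ hi)]
    · intro ℓ hℓ
      rcases mem_labels_node.1 hℓ with rfl | ⟨i, ℓ', hℓ', rfl⟩
      · refine ⟨by rw [hrk]; exact hwp, ⟨a, hwr, rfl⟩, .inr ⟨b, ⟨hrk.symm, hwf⟩, hcb⟩⟩
      · have := (hD (Fin.cast hrk i)).isPiece ℓ' hℓ'
        have hi : i.val < rkα b := hrk ▸ i.2
        simp only [hi, dif_pos]
        exact this
    · have hlen' : (node (cl a, true) fun i => Ds (Fin.cast hrk i)).syms.length =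
          1 + ∑ i, (Ds i).syms.length := by
        simp only [syms, List.length_cons, List.length_flatten, List.map_ofFn, List.sum_ofFn,
          Function.comp_def, Nat.add_comm 1]
        congr 1
        exact Fintype.sum_equiv (finCongr hrk) _ _ fun i => rfl
      have hsum : ∑ i, (us i).vars.length = (node a ts).vars.length := by
        rw [← hvars]
        simp only [vars, List.length_flatten, List.map_ofFn, List.sum_ofFn, Function.comp_def]
      have hle : ∀ i, (us i).vars.length ≤ (node a ts).vars.length := fun i =>
        hvars ▸ (vars_sublist_node us i).length_le
      have hm : rkα b ≤ m := hrb ▸ hcr _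
      have hca : cl a ∈ mainClasses cl (node a ts) :=
        (mem_mainClasses cl).2 ⟨a, ts, .refl _, rfl, rfl⟩
      have hk : (node a ts).vars.length ≠ 0 := by simpa using hv
      rw [hlen', pieceBound, if_neg hk]
      by_cases hall : ∃ i, (us i).vars.length = (node a ts).vars.length
      · obtain ⟨i, hi⟩ := hall
        have hvi : (us i).vars = (node a ts).vars :=
          hvars ▸ (vars_sublist_node us i).eq_of_length (hi.trans (congrArg _ hvars.symm))
        have hcls : (mainClasses cl (us i)).card + 1 ≤ (mainClasses cl (node a ts)).card := by
          -- Otherwise there would be a smaller place for the cut.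
          have hna : cl a ∉ mainClasses cl (us i) := by
            rw [mem_mainClasses]
            rintro ⟨b', us', h₁, h₂, h₃⟩
            have := hmin b' us' ((Subterm.child i h₁).trans hsub) (h₂.trans hvi) h₃
            exact absurd (this.trans h₁.size_le) (not_le.2 (size_lt_node us i))
          rw [← Finset.card_insert_of_notMem hna]
          refine Finset.card_le_card (Finset.insert_subset hca fun c hc => ?_)
          obtain ⟨b', us', h₁, h₂, h₃⟩ := (mem_mainClasses cl).1 hc
          exact (mem_mainClasses cl).2
            ⟨b', us', (Subterm.child i h₁).trans hsub, h₂.trans hvi, h₃⟩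
        have hother : ∀ j ∈ Finset.univ.erase i, (Ds j).syms.length ≤ 1 := fun j hj => by
          have h0 : (us j).vars.length = 0 := by
            rw [List.length_eq_zero_iff, List.eq_nil_iff_forall_not_mem]
            intro x hx
            refine not_mem_vars_of_ne hbn (Finset.ne_of_mem_erase hj) hx ?_
            rw [hvi, ← hvars]
            exact (vars_sublist_node us j).subset hx
          simpa [pieceBound, h0] using hlen j
        have h₁ := Finset.sum_le_card_nsmul _ _ _ hother
        rw [Finset.card_erase_of_mem (Finset.mem_univ i), Finset.card_univ, Fintype.card_fin,
          smul_eq_mul, mul_one] at h₁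
        rw [← Finset.add_sum_erase _ _ (Finset.mem_univ i)]
        have h₂ := hlen i
        rw [pieceBound, hi, if_neg hk] at h₂
        -- The context and the variable-free children cost at most `1 + (rkα b - 1) ≤ m` pieces,
        -- paid for by the lost class.
        have h₃ := Nat.mul_le_mul_left m hcls
        rw [Nat.mul_add, Nat.mul_one] at h₃
        have := i.pos
        omega
      · have hlt : ∀ i, (us i).vars.length < (node a ts).vars.length := fun i =>
          lt_of_le_of_ne (hle i) fun h => hall ⟨i, h⟩
        have h := sum_pieceBound_le (m := m) (n := n) (fun i => (Ds i).syms.length) _ hm hk hsum hlt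
          fun i => (hlen i).trans (by
            unfold pieceBound
            have := Finset.card_le_univ (mainClasses cl (us i))
            rw [Fintype.card_fin] at this
            split_ifs
            · rfl
            · gcongr)
        have h₁ : 1 ≤ (mainClasses cl (node a ts)).card := Finset.card_pos.2 ⟨_, hca⟩
        have := Nat.mul_le_mul_left m h₁
        omega

end RTerm

end TreeGrammar

namespace TreeGrammar

/-! ### Patterns under substitution. -/

namespace RTerm

theorem mem_syms_of_mem_labels {β V : Type*} {rkβ : β → ℕ} {t : RTerm rkβ V} {ℓ : List ℕ × β}
    (h : ℓ ∈ t.labels) : ℓ.2 ∈ t.syms := by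
  rw [← labels_map_snd]
  exact List.mem_map_of_mem h

theorem root_toPattern {α : Type*} {rk : α → ℕ} (t : RTree rk) : t.toPattern.root = t.root := by
  rcases t with e | ⟨a, ts⟩
  exacts [e.elim, rfl]

theorem IsPattern.exists_tree {α : Type*} {rk : α → ℕ} {t : RTerm rk ℕ} (h : IsPattern 0 t) :
    ∃ s : RTree rk, s.toPattern = t := by
  replace h : t.vars = [] := by simpa [IsPattern] using h
  induction t with
  | var x => simp [vars] at h
  | node a ts ih =>
    have h' : ∀ i, (ts i).vars = [] := fun i =>
      List.sublist_nil.1 (h ▸ vars_sublist_node ts i)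
    choose ss hs using fun i => ih i (h' i)
    refine ⟨node a ss, ?_⟩
    simp only [RTree.toPattern, bind] at hs ⊢
    simp only [hs]

theorem pattern_gsubst {α β : Type*} {rkα : α → ℕ} {rkβ : β → ℕ} {t : RTerm rkβ ℕ}
    {g : β → RTerm rkα ℕ} (h : ∀ b ∈ t.syms, IsPattern (rkβ b) (g b)) {k : ℕ}
    (ht : IsPattern k t) : IsPattern k (gsubst g t) :=
  (vars_psubst fun _ hℓ => h _ (mem_syms_of_mem_labels hℓ)).trans ht

variable {N T : Type*} {rkN : N → ℕ} {rk : T → ℕ}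

theorem subst_congr {f g : N → RTerm rk ℕ} {t : RTerm (Sum.elim rkN rk) ℕ}
    (h : ∀ C, Sum.inl C ∈ t.syms → f C = g C) : subst f t = subst g t := by
  rw [subst_eq_gsubst, subst_eq_gsubst]
  refine gsubst_congr ?_
  rintro (C | σ) hb
  exacts [h C hb, rfl]

theorem pattern_subst {f : N → RTerm rk ℕ} {t : RTerm (Sum.elim rkN rk) ℕ}
    (h : ∀ C, Sum.inl C ∈ t.syms → IsPattern (rkN C) (f C)) {k : ℕ} (ht : IsPattern k t) :
    IsPattern k (subst f t) := by
  rw [subst_eq_gsubst]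
  refine pattern_gsubst ?_ ht
  rintro (C | σ) hb
  exacts [h C hb, init_isPattern σ]

end RTerm

open RTerm

/-! ## Functions given by lists -/

section Lists

variable {N Y : Type*}

open Classical in
/-- The function that maps the elements of `l` to the corresponding elements of `r`. -/
noncomputable def listFun (l : List N) (r : List Y) (dflt : Y) (C : N) : Y :=
  ((l.zip r).lookup C).getD dflt

theorem map_listFun {l : List N} (hl : l.Nodup) : ∀ {r : List Y} (_ : l.length = r.length)
    (dflt : Y), l.map (listFun l r dflt) = r := by
  classical
  induction l with
  | nil => intro r h _; simpa using h.symm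
  | cons a l ih =>
    rintro (_ | ⟨b, r⟩) h dflt
    · simp at h
    rw [List.nodup_cons] at hl
    rw [List.map_cons]
    congr 1
    · simp [listFun]
    · refine Eq.trans (List.map_congr_left fun c hc => ?_)
        (ih hl.2 (r := r) (by simpa using h) dflt)
      have : (c == a) = false := by simpa using fun h : c = a => hl.1 (h ▸ hc)
      rw [listFun, listFun, List.zip_cons_cons, List.lookup_cons, this]

/-- The function that agrees with `y i` on the `i`-th list. -/
noncomputable def combine (links : List (List N)) (y : Fin links.length → N → Y) (dflt : N → Y)
    (C : N) : Y :=
  open Classical in if h : ∃ i, C ∈ links.get i then y h.choose C else dflt C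

theorem get_unique {links : List (List N)} (hn : links.flatten.Nodup) {i j : Fin links.length}
    {C : N} (hi : C ∈ links.get i) (hj : C ∈ links.get j) : i = j := by
  by_contra hij
  have hp := (List.nodup_flatten.1 hn).2
  rw [List.pairwise_iff_get] at hp
  rcases lt_or_gt_of_ne hij with h | h
  · exact hp _ _ h hi hj
  · exact hp _ _ h hj hi

theorem combine_eq {links : List (List N)} (hn : links.flatten.Nodup)
    (y : Fin links.length → N → Y) (dflt : N → Y) {i : Fin links.length} {C : N}
    (hC : C ∈ links.get i) : combine links y dflt C = y i C := by
  have h : ∃ i, C ∈ links.get i := ⟨i, hC⟩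
  rw [combine, dif_pos h, get_unique hn h.choose_spec hC]

theorem mem_flatten_iff_get {links : List (List N)} {C : N} :
    C ∈ links.flatten ↔ ∃ i, C ∈ links.get i := by
  rw [List.mem_flatten]
  constructor
  · rintro ⟨B, hB, hC⟩
    obtain ⟨i, rfl⟩ := List.get_of_mem hB
    exact ⟨i, hC⟩
  · rintro ⟨i, hC⟩
    exact ⟨_, List.get_mem _ _, hC⟩

end Lists

theorem mem_nonterminals {N T : Type*} {rkN : N → ℕ} {rk : T → ℕ}
    {u : List (RTerm (Sum.elim rkN rk) ℕ)} {C : N} :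
    C ∈ nonterminals u ↔ ∃ t ∈ u, Sum.inl C ∈ t.syms := by
  simp only [nonterminals, List.mem_filterMap, List.mem_flatMap]
  constructor
  · rintro ⟨a, ⟨t, ht, ha⟩, h⟩
    rw [Sum.getLeft?_eq_some_iff] at h
    exact ⟨t, ht, h ▸ ha⟩
  · rintro ⟨t, ht, h⟩
    exact ⟨_, ⟨t, ht, h⟩, rfl⟩

theorem RTG.gen_node {Ω : Type*} {rk : Ω → ℕ} {H : RTG rk} {A : H.NT} {a : Ω}
    {ts : Fin (rk a) → RTree rk} : H.Gen A (node a ts) ↔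
      ∃ As, H.rules A a As ∧ ∀ i, H.Gen (As i) (ts i) := by
  constructor
  · intro h
    cases h with
    | mk _ _ As _ h₁ h₂ => exact ⟨As, h₁, h₂⟩
  · rintro ⟨As, h₁, h₂⟩
    exact .mk _ _ _ _ h₁ h₂

namespace MCFTG

variable {T : Type*} {rk : T → ℕ} (G : MCFTG rk)

/-! ## Values of derivation trees -/

theorem linkSubst_eq {N : Type*} {links : List (List N)}
    {vals : Fin links.length → List (RTerm rk ℕ)} {f : N → RTerm rk ℕ}
    (h : ∀ i, vals i = (links.get i).map f) {C : N} (hC : C ∈ links.flatten) :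
    linkSubst links vals C = f C := by
  classical
  have h₁ : (List.ofFn fun i => (links.get i).zip (vals i)).flatten =
      links.flatten.map fun C => (C, f C) := by
    have : (List.ofFn fun i => (links.get i).zip (vals i)) =
        links.map (List.map fun C => (C, f C)) := by
      conv_rhs => rw [← List.ofFn_get links, List.map_ofFn]
      congr 1
      funext i
      rw [h, Function.comp]
      generalize links.get i = l
      induction l with
      | nil => rfl
      | cons a l ih => simp [ih]
    rw [this, List.map_flatten]
  have h₂ : ∀ l : List N, C ∈ l → (l.map fun C => (C, f C)).lookup C = some (f C) := by
    intro l hl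
    induction l with
    | nil => simp at hl
    | cons a l ih =>
      by_cases ha : C = a
      · subst ha; simp
      · rw [List.map_cons, List.lookup_cons]
        have : (C == a) = false := by simpa using ha
        rw [this]
        exact ih (by simpa [ha] using hl)
  unfold linkSubst
  rw [h₁]
  exact (congrArg (Option.getD · (RTerm.var 0)) (by convert h₂ _ hC)).trans rfl

theorem val_node {ρ : G.R} {ds : Fin (G.ruleRank ρ) → RTree G.ruleRank} {f : G.NT → RTerm rk ℕ}
    (h : ∀ i, G.val (ds i) = (ρ.1.links.get i).map f) :
    G.val (node ρ ds) = ρ.1.rhs.map (subst f) := by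
  rw [val]
  refine List.map_congr_left fun t ht => subst_congr fun C hC => linkSubst_eq h ?_
  exact (G.mem_links _ ρ.2 C).2 (mem_nonterminals.2 ⟨t, ht, hC⟩)

/-- `d` is a derivation tree whose root is labelled by a rule with left-hand side `A`. -/
def Der (A : List G.NT) (d : RTree G.ruleRank) : Prop := ∃ h : A ∈ G.big, G.derGrammar.Gen ⟨A, h⟩ d

theorem der_node {A : List G.NT} {ρ : G.R} {ds : Fin (G.ruleRank ρ) → RTree G.ruleRank} :
    G.Der A (node ρ ds) ↔ ρ.1.lhs = A ∧ ∀ i, G.Der (ρ.1.links.get i) (ds i) := by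
  constructor
  · rintro ⟨hA, h⟩
    obtain ⟨As, h₁, h₂⟩ := RTG.gen_node.1 h
    refine ⟨h₁.1, fun i => ?_⟩
    have h := h₂ i
    have e : As i = ⟨ρ.1.links.get i, G.links_mem _ ρ.2 _ (List.get_mem _ _)⟩ :=
      Subtype.ext (h₁.2 i)
    rw [e] at h
    exact ⟨_, h⟩
  · rintro ⟨rfl, h⟩
    exact ⟨G.lhs_mem _ ρ.2, RTG.gen_node.2 ⟨fun i => ⟨ρ.1.links.get i, (h i).choose⟩,
      ⟨rfl, fun _ => rfl⟩, fun i => (h i).choose_spec⟩⟩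

theorem mem_language_iff {d : RTree G.ruleRank} :
    d ∈ G.derGrammar.language ↔ G.Der [G.start] d :=
  ⟨fun h => ⟨G.start_mem, h⟩, fun ⟨_, h⟩ => h⟩

/-- The pattern of the right-hand side of `ρ` that corresponds to `C` in the left-hand side. -/
noncomputable def rhsOf (ρ : G.R) : G.NT → RTerm (Sum.elim G.rkN rk) ℕ :=
  listFun ρ.1.lhs ρ.1.rhs (var 0)

theorem map_rhsOf (ρ : G.R) : ρ.1.lhs.map (G.rhsOf ρ) = ρ.1.rhs :=
  map_listFun (G.big_nodup _ (G.lhs_mem _ ρ.2)) (G.rhs_rank _ ρ.2).length_eq _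

theorem rhsOf_isPattern (ρ : G.R) {C : G.NT} (hC : C ∈ ρ.1.lhs) :
    IsPattern (G.rkN C) (G.rhsOf ρ C) := by
  have h := G.rhs_rank _ ρ.2
  rw [← G.map_rhsOf ρ, List.forall₂_map_right_iff, List.forall₂_same] at h
  exact h C hC

theorem mem_links_of_mem_rhsOf {ρ : G.R} {C C' : G.NT} (hC : C ∈ ρ.1.lhs)
    (h : Sum.inl C' ∈ (G.rhsOf ρ C).syms) : C' ∈ ρ.1.links.flatten := by
  rw [G.mem_links _ ρ.2, mem_nonterminals]
  refine ⟨_, ?_, h⟩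
  rw [← G.map_rhsOf ρ]
  exact List.mem_map_of_mem hC

theorem Der.exists_val {A : List G.NT} {d : RTree G.ruleRank} (h : G.Der A d) :
    ∃ f : G.NT → RTerm rk ℕ, G.val d = A.map f ∧ ∀ C ∈ A, IsPattern (G.rkN C) (f C) := by
  induction d generalizing A with
  | var e => exact e.elim
  | node ρ ds ih =>
    obtain ⟨rfl, hd⟩ := G.der_node.1 h
    choose fs hf hp using fun i => ih i (hd i)
    have hn := G.links_nodup _ ρ.2
    set f := combine ρ.1.links fs (fun _ => var 0) with hfdef
    have hv : ∀ i, G.val (ds i) = (ρ.1.links.get i).map f := fun i => by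
      rw [hf]
      exact List.map_congr_left fun C hC => (combine_eq hn fs _ hC).symm
    refine ⟨fun C => subst f (G.rhsOf ρ C), ?_, fun C hC => ?_⟩
    · rw [G.val_node hv, ← G.map_rhsOf ρ, List.map_map]
      rfl
    · refine pattern_subst (fun C' hC' => ?_) (G.rhsOf_isPattern ρ hC)
      obtain ⟨i, hi⟩ := mem_flatten_iff_get.1 (G.mem_links_of_mem_rhsOf hC hC')
      rw [hfdef, combine_eq hn fs _ hi]
      exact hp i C' hi

theorem Der.gen_val {A : List G.NT} {d : RTree G.ruleRank} (h : G.Der A d) :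
    G.Gen A (G.val d) := by
  induction d generalizing A with
  | var e => exact e.elim
  | node ρ ds ih =>
    obtain ⟨rfl, hd⟩ := G.der_node.1 h
    choose fs hf _ using fun i => (hd i).exists_val
    have hn := G.links_nodup _ ρ.2
    have hv : ∀ i, G.val (ds i) = (ρ.1.links.get i).map (combine ρ.1.links fs fun _ => var 0) :=
      fun i => by
        rw [hf]
        exact List.map_congr_left fun C hC => (combine_eq hn fs _ hC).symm
    rw [G.val_node hv]
    refine .mk ρ.1 _ ρ.2 fun B hB => ?_
    obtain ⟨i, rfl⟩ := List.get_of_mem hB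
    rw [← hv]
    exact ih i (hd i)

theorem Der.exists_tree {d : RTree G.ruleRank} (h : G.Der [G.start] d) :
    ∃ t ∈ G.treeLanguage, G.val d = [t.toPattern] := by
  obtain ⟨f, hf, hp⟩ := h.exists_val
  have hp := hp G.start (by simp)
  rw [G.start_rank] at hp
  obtain ⟨t, ht⟩ := hp.exists_tree
  have hv : G.val d = [t.toPattern] := by rw [hf, ht]; rfl
  exact ⟨t, by rw [treeLanguage, Set.mem_ofPred_eq, ← hv]; exact h.gen_val, hv⟩

end MCFTG

end TreeGrammar

namespace TreeGrammar

open RTerm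

/-! ## Finitely many small trees -/

/-- Variables carry no symbols and come from an infinite set, so they need a bound of their own. -/
theorem finite_small_trees {β : Type*} [Finite β] (rkβ : β → ℕ) (K W : ℕ) :
    {D : RTerm rkβ ℕ | D.syms.length ≤ K ∧ ∀ x ∈ D.vars, x ≤ W}.Finite := by
  induction K with
  | zero =>
    refine ((Set.finite_Iic W).image var).subset ?_
    rintro (x | ⟨b, ts⟩) ⟨h₁, h₂⟩
    · exact ⟨x, h₂ x (by simp [vars]), rfl⟩
    · simp [syms] at h₁
  | succ K ih =>
    refine (((Set.finite_Iic W).image var).union (Set.finite_iUnion fun b : β =>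
      (Set.Finite.pi fun _ : Fin (rkβ b) => ih).image (node b))).subset ?_
    rintro (x | ⟨b, ts⟩) ⟨h₁, h₂⟩
    · exact .inl ⟨x, h₂ x (by simp [vars]), rfl⟩
    · refine .inr (Set.mem_iUnion.2 ⟨b, ts, fun i _ => ⟨?_, fun x hx => ?_⟩, rfl⟩)
      · have h : (ts i).syms.Sublist (List.ofFn fun i => (ts i).syms).flatten :=
          List.sublist_flatten_of_mem (List.mem_ofFn.2 ⟨i, rfl⟩)
        have := h.length_le
        simp only [syms, List.length_cons] at h₁
        omega
      · exact h₂ x (mem_vars_node.2 ⟨i, hx⟩)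

/-! ## Substitution and lists of symbols -/

theorem RTerm.syms_gsubst {α β : Type*} {rkα : α → ℕ} {rkβ : β → ℕ} {t : RTerm rkβ ℕ}
    {g : β → RTerm rkα ℕ} (h : ∀ b ∈ t.syms, IsPattern (rkβ b) (g b)) :
    (gsubst g t).syms.Perm (t.syms.flatMap fun b => (g b).syms) := by
  refine (syms_psubst fun _ hℓ => h _ (mem_syms_of_mem_labels hℓ)).trans ?_
  rw [← labels_map_snd, List.flatMap_map]

theorem RTerm.syms_init {α : Type*} {rk : α → ℕ} (a : α) : (init rk a).syms = [a] := by
  simp [init, syms]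

theorem List.Perm.flatMap_congr {α β : Type*} {l : List α} {f g : α → List β}
    (h : ∀ a ∈ l, (f a).Perm (g a)) : (l.flatMap f).Perm (l.flatMap g) := by
  induction l with
  | nil => exact .refl _
  | cons a l ih =>
    simp only [List.flatMap_cons]
    exact (h a (by simp)).append (ih fun b hb => h b (by simp [hb]))

namespace MCFTG

variable {T : Type*} {rk : T → ℕ}

theorem rkN_le_width (G : MCFTG rk) (C : G.NT) : G.rkN C ≤ G.width :=
  Finset.le_sup (f := G.rkN) (@Finset.mem_univ _ G.fintypeNT C)

variable [Fintype T]

/-! ## Shapes -/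

/-- The rank of the terminal with a given number. -/
noncomputable def classRank (rk : T → ℕ) (i : Fin (Fintype.card T)) : ℕ :=
  rk ((Fintype.equivFin T).symm i)

/-- The maximal rank of the terminals. -/
abbrev maxRank (rk : T → ℕ) : ℕ := Finset.univ.sup rk

theorem classRank_le (i : Fin (Fintype.card T)) : classRank rk i ≤ maxRank rk :=
  Finset.le_sup (f := rk) (Finset.mem_univ _)

theorem classRank_equivFin (σ : T) : classRank rk (Fintype.equivFin T σ) = rk σ := by
  simp [classRank]

abbrev ShapeLabel (_ : T → ℕ) : Type := Fin (Fintype.card T) × Bool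

noncomputable abbrev labelRank (rk : T → ℕ) : ShapeLabel rk → ℕ := shapeRank (classRank rk)

/-- The bound on the number of pieces of a `k`-ary pattern. -/
def shapeBound (rk : T → ℕ) (k : ℕ) : ℕ :=
  if k = 0 then 1 else maxRank rk * Fintype.card T * (2 * k - 1)

/-- A terminal of positive rank is needed for the step from `k = 0`, where the bound is 1 and not
given by the product. -/
theorem shapeBound_mono (h : ∃ σ, 1 ≤ rk σ) {k l : ℕ} (hkl : k ≤ l) :
    shapeBound rk k ≤ shapeBound rk l := by
  obtain ⟨σ, hσ⟩ := h
  have h₁ : 1 ≤ maxRank rk := hσ.trans (Finset.le_sup (f := rk) (Finset.mem_univ σ))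
  have h₂ : 1 ≤ Fintype.card T := Fintype.card_pos_iff.2 ⟨σ⟩
  have h₃ := Nat.mul_le_mul h₁ h₂
  unfold shapeBound
  split_ifs
  · rfl
  · have : 1 ≤ 2 * l - 1 := by omega
    exact (Nat.mul_le_mul h₃ this)
  · omega
  · gcongr

theorem pieceBound_le_shapeBound (c : Finset (Fin (Fintype.card T))) (k : ℕ) :
    pieceBound (maxRank rk) (Fintype.card T) c.card k ≤ shapeBound rk k := by
  unfold pieceBound shapeBound
  split_ifs with h
  · rfl
  · have h₁ : c.card ≤ Fintype.card T := by simpa using Finset.card_le_univ c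
    have h₂ := Nat.mul_le_mul_left (maxRank rk) h₁
    have : 2 * k - 1 = (2 * k - 2) + 1 := by omega
    rw [this, Nat.mul_add, Nat.mul_one]
    omega

variable (G : MCFTG rk)

/-- The shapes that occur in the construction. -/
def ShapeSet : Set (RTerm (labelRank rk) ℕ) :=
  {D | D.syms.length ≤ shapeBound rk G.width ∧ ∀ x ∈ D.vars, x ≤ G.width}

theorem finite_shapeSet : G.ShapeSet.Finite := finite_small_trees _ _ _

/-- A big nonterminal together with shapes for its elements. -/
abbrev Link : Type := {A : List G.NT // A ∈ G.big} × (G.NT → G.ShapeSet)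

instance : Finite G.Link := by
  have := G.finite_shapeSet.to_subtype
  have := Fintype.finite G.fintypeNT
  infer_instance

/-- Restricting to positions in admissible shapes keeps the set of new nonterminals finite. -/
def Position : Set (List ℕ × ShapeLabel rk) := {ℓ | ∃ D ∈ G.ShapeSet, ℓ ∈ D.labels}

theorem finite_position : G.Position.Finite := by
  have : G.Position = ⋃ D ∈ G.ShapeSet, {ℓ | ℓ ∈ D.labels} := by
    ext ℓ
    simp [Position]
  rw [this]
  exact G.finite_shapeSet.biUnion fun D _ => List.finite_toSet _

/-- The new nonterminals: `none` is the initial nonterminal, and `some (p, C, ℓ)` generates the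
piece at position `ℓ` of the pattern generated by `C`. -/
abbrev Component : Type := Option (G.Link × G.NT × G.Position)

instance : Finite G.Component := by
  have := G.finite_position.to_subtype
  have := Fintype.finite G.fintypeNT
  infer_instance

noncomputable def componentRank : G.Component → ℕ
  | none => 0
  | some x => labelRank rk x.2.2.1.2

-- Total in `ℓ` for convenience; the value `none` for a foreign position never arises from a shape
-- in `G.ShapeSet`.
open Classical in
noncomputable def component (p : G.Link) (C : G.NT) (ℓ : List ℕ × ShapeLabel rk) : G.Component :=
  if h : ℓ ∈ G.Position then some (p, C, ⟨ℓ, h⟩) else none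

variable {G}

theorem component_of_mem {p : G.Link} {C : G.NT} {ℓ : List ℕ × ShapeLabel rk}
    (h : ℓ ∈ G.Position) : G.component p C ℓ = some (p, C, ⟨ℓ, h⟩) := dif_pos h

theorem mem_position {D : G.ShapeSet} {ℓ : List ℕ × ShapeLabel rk} (h : ℓ ∈ D.1.labels) :
    ℓ ∈ G.Position := ⟨D.1, D.2, h⟩

/-- The components of `C`. -/
noncomputable def Link.components (p : G.Link) (C : G.NT) : List G.Component :=
  (p.2 C).1.labels.map (G.component p C)

/-- The big nonterminal of the new grammar (or the empty list) that is given by `p`. -/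
noncomputable def Link.all (p : G.Link) : List G.Component := p.1.1.flatMap p.components

theorem Link.mem_components {p : G.Link} {C : G.NT} {x : G.Component} :
    x ∈ p.components C ↔ ∃ (ℓ : List ℕ × ShapeLabel rk) (h : ℓ ∈ (p.2 C).1.labels),
      x = some (p, C, ⟨ℓ, mem_position h⟩) := by
  simp only [components, List.mem_map]
  constructor
  · rintro ⟨ℓ, h, rfl⟩
    exact ⟨ℓ, h, component_of_mem _⟩
  · rintro ⟨ℓ, h, rfl⟩
    exact ⟨ℓ, h, component_of_mem _⟩

theorem Link.components_nodup (p : G.Link) (C : G.NT) : (p.components C).Nodup := by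
  refine List.Nodup.map_on (fun ℓ hℓ ℓ' hℓ' h => ?_) (labels_nodup _)
  rw [component_of_mem (mem_position hℓ), component_of_mem (mem_position hℓ')] at h
  simpa using h

/-- A new nonterminal carries its link and its old nonterminal in its name. This yields disjointness
of big nonterminals, repetition-freeness and the recovery of shapes from a single component. -/
theorem Link.eq_of_mem_components {p p' : G.Link} {C C' : G.NT} {x : G.Component}
    (h : x ∈ p.components C) (h' : x ∈ p'.components C') : p = p' ∧ C = C' := by
  obtain ⟨ℓ, hℓ, rfl⟩ := mem_components.1 h
  obtain ⟨ℓ', hℓ', e⟩ := mem_components.1 h'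
  simp only [Option.some.injEq, Prod.mk.injEq] at e
  exact ⟨e.1, e.2.1⟩

theorem Link.eq_of_mem_all {p p' : G.Link} {x : G.Component}
    (h : x ∈ p.all) (h' : x ∈ p'.all) : p = p' := by
  obtain ⟨C, -, h⟩ := List.mem_flatMap.1 h
  obtain ⟨C', -, h'⟩ := List.mem_flatMap.1 h'
  exact (eq_of_mem_components h h').1

theorem Link.none_notMem_all (p : G.Link) : none ∉ p.all := by
  intro h
  obtain ⟨C, -, h : none ∈ p.components C⟩ := List.mem_flatMap.1 h
  obtain ⟨_, _, h⟩ := mem_components.1 h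
  cases h

theorem nodup_flatMap_components {l : List G.NT} (hl : l.Nodup) (τ : G.NT → G.Link) :
    (l.flatMap fun C => (τ C).components C).Nodup := by
  rw [List.nodup_flatMap]
  refine ⟨fun C _ => (τ C).components_nodup C, hl.imp fun {C C'} hC x h h' => ?_⟩
  exact hC (Link.eq_of_mem_components h h').2

theorem Link.all_nodup (p : G.Link) : p.all.Nodup :=
  nodup_flatMap_components (G.big_nodup _ p.1.2) fun _ => p

noncomputable abbrev symbolRank (G : MCFTG rk) : G.Component ⊕ T → ℕ :=
  Sum.elim G.componentRank rk

/-- The shape of `C` with the components of `C` as labels. -/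
noncomputable def Link.tree (p : G.Link) (C : G.NT) : RTerm G.symbolRank ℕ :=
  (p.2 C).1.psubst fun q b => init G.symbolRank (.inl (G.component p C (q, b)))

theorem component_init_isPattern {p : G.Link} {C : G.NT} {ℓ : List ℕ × ShapeLabel rk}
    (h : ℓ ∈ G.Position) : IsPattern (labelRank rk ℓ.2)
      (init G.symbolRank (.inl (G.component p C ℓ))) := by
  have := init_isPattern (rkα := G.symbolRank) (.inl (G.component p C ℓ))
  rw [component_of_mem h] at this ⊢
  exact this

theorem Link.tree_isPattern {p : G.Link} {C : G.NT} {k : ℕ} (h : IsPattern k (p.2 C).1) :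
    IsPattern k (p.tree C) :=
  (vars_psubst fun _ hℓ => component_init_isPattern (mem_position hℓ)).trans h

theorem Link.syms_tree (p : G.Link) (C : G.NT) :
    (p.tree C).syms.Perm ((p.components C).map Sum.inl) := by
  refine (syms_psubst fun _ hℓ => component_init_isPattern (mem_position hℓ)).trans ?_
  simp only [syms_init, components, List.map_map]
  rw [List.map_eq_flatMap]
  exact .refl _

/-- The class of a symbol of the new grammar. -/
noncomputable def symbolClass (G : MCFTG rk) : G.Component ⊕ T → Fin (Fintype.card T)
  | .inl none => Fintype.equivFin T G.exists_pos_rank.choose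
  | .inl (some x) => x.2.2.1.2.1
  | .inr σ => Fintype.equivFin T σ

/-- The rank hypothesis of `exists_decomp`: a component is treated like a terminal of its class, or
like a leaf. -/
theorem symbolRank_eq (a : G.Component ⊕ T) :
    G.symbolRank a = 0 ∨ G.symbolRank a = classRank rk (G.symbolClass a) := by
  rcases a with (_ | ⟨p, C, ⟨q, i, b⟩, h⟩) | σ
  · exact .inl rfl
  · cases b
    · exact .inl rfl
    · exact .inr rfl
  · exact .inr (classRank_equivFin σ).symm

/-- A chosen decomposition of `t`. -/
noncomputable def decomp (G : MCFTG rk) (t : RTerm G.symbolRank ℕ) :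
    G.ShapeSet × (List ℕ → ShapeLabel rk → RTerm G.symbolRank ℕ) :=
  open Classical in
  if h : ∃ D : G.ShapeSet × (List ℕ → ShapeLabel rk → RTerm G.symbolRank ℕ),
    IsDecomp G.symbolClass (classRank rk) t D.1.1 D.2 ∧
      D.1.1.syms.length ≤ shapeBound rk t.vars.length then h.choose
  else (⟨var 0, by simp [ShapeSet, syms, vars]⟩, fun _ _ => var 0)

/-- Pieces are patterns, so the shape has the same variables as `t` up to order. Its rank is thus at
most the width, and it lies in the finite set of shapes. -/
theorem decomp_spec {t : RTerm G.symbolRank ℕ} {k : ℕ} (ht : IsPattern k t) (hk : k ≤ G.width) :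
    IsDecomp G.symbolClass (classRank rk) t (G.decomp t).1.1 (G.decomp t).2 ∧
      (G.decomp t).1.1.syms.length ≤ shapeBound rk k ∧ IsPattern k (G.decomp t).1.1 := by
  have hlen : t.vars.length = k := by simpa using ht.length_eq
  have hpat : ∀ {D F}, IsDecomp G.symbolClass (classRank rk) t D F → IsPattern k D :=
    fun {D F} h => by
      have := vars_psubst fun ℓ hℓ => (h.isPiece ℓ hℓ).isPattern
      rw [h.psubst_eq] at this
      exact this.symm.trans ht
  have h : ∃ D : G.ShapeSet × (List ℕ → ShapeLabel rk → RTerm G.symbolRank ℕ),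
      IsDecomp G.symbolClass (classRank rk) t D.1.1 D.2 ∧
        D.1.1.syms.length ≤ shapeBound rk t.vars.length := by
    obtain ⟨D, F, hD, hb⟩ := exists_decomp G.symbolClass (classRank rk) classRank_le symbolRank_eq
      t (ht.nodup_iff.2 List.nodup_range)
    have hb := hb.trans (pieceBound_le_shapeBound _ _)
    refine ⟨(⟨D, ?_, fun x hx => ?_⟩, F), hD, hb⟩
    · exact hb.trans (shapeBound_mono G.exists_pos_rank (hlen ▸ hk))
    · exact ((hpat hD).lt x hx).le.trans hk
  have hs := h.choose_spec
  have e : G.decomp t = h.choose := by rw [decomp, dif_pos h]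
  rw [← e, hlen] at hs
  exact ⟨hs.1, hs.2, hpat hs.1⟩

/-! ## The right-hand sides of the new rules -/

variable (G)

noncomputable def defaultLink : G.Link :=
  (⟨[G.start], G.start_mem⟩, fun _ => ⟨var 0, by simp [ShapeSet, syms, vars]⟩)

variable {G}

/-- The link that contains a given nonterminal of the right-hand side of `ρ`. -/
noncomputable def linkOf (ρ : G.R) (ps : Fin (G.ruleRank ρ) → G.Link) : G.NT → G.Link :=
  combine ρ.1.links (fun i _ => ps i) fun _ => G.defaultLink

theorem linkOf_eq {ρ : G.R} {ps : Fin (G.ruleRank ρ) → G.Link} {i : Fin (G.ruleRank ρ)} {C : G.NT}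
    (h : C ∈ ρ.1.links.get i) : linkOf ρ ps C = ps i :=
  combine_eq (G.links_nodup _ ρ.2) _ _ h

/-- The substitution of trees of components for nonterminals. -/
noncomputable def expand (τ : G.NT → G.Link) : G.NT ⊕ T → RTerm G.symbolRank ℕ :=
  Sum.elim (fun C => (τ C).tree C) fun σ => init G.symbolRank (.inr σ)

noncomputable def expandedRhs (ρ : G.R) (ps : Fin (G.ruleRank ρ) → G.Link) (C : G.NT) :
    RTerm G.symbolRank ℕ :=
  gsubst (expand (linkOf ρ ps)) (G.rhsOf ρ C)

/-- The left-hand side of `ρ` with the shapes that result from the shapes of the links. -/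
noncomputable def next (ρ : G.R) (ps : Fin (G.ruleRank ρ) → G.Link) : G.Link :=
  open Classical in
  (⟨ρ.1.lhs, G.lhs_mem _ ρ.2⟩, fun C =>
    if C ∈ ρ.1.lhs then (G.decomp (expandedRhs ρ ps C)).1 else G.defaultLink.2 C)

/-- The right-hand side of the new rule for a component of the left-hand side. -/
noncomputable def piece (ρ : G.R) (ps : Fin (G.ruleRank ρ) → G.Link) :
    G.Component → RTerm G.symbolRank ℕ
  | none => var 0
  | some x => (G.decomp (expandedRhs ρ ps x.2.1)).2 x.2.2.1.1 x.2.2.1.2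

noncomputable def newRhs (ρ : G.R) (ps : Fin (G.ruleRank ρ) → G.Link) :
    List (RTerm G.symbolRank ℕ) :=
  (next ρ ps).all.map (piece ρ ps)

/-- The links of `ρ` are those of `ps`, with shapes of the correct ranks. -/
def Fits (ρ : G.R) (ps : Fin (G.ruleRank ρ) → G.Link) : Prop :=
  ∀ i, (ps i).1.1 = ρ.1.links.get i ∧ ∀ C ∈ (ps i).1.1, IsPattern (G.rkN C) ((ps i).2 C).1

/-! ### Properties of the new right-hand sides. -/

section

variable {ρ : G.R} {ps : Fin (G.ruleRank ρ) → G.Link}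

theorem next_apply {C : G.NT} (h : C ∈ ρ.1.lhs) :
    (next ρ ps).2 C = (G.decomp (expandedRhs ρ ps C)).1 := if_pos h

theorem linkOf_isPattern (hp : Fits ρ ps) {C : G.NT} (hC : C ∈ ρ.1.links.flatten) :
    IsPattern (G.rkN C) ((linkOf ρ ps C).2 C).1 := by
  obtain ⟨i, hi⟩ := mem_flatten_iff_get.1 hC
  rw [linkOf_eq hi]
  exact (hp i).2 C ((hp i).1 ▸ hi)

theorem expand_isPattern (hp : Fits ρ ps) {C : G.NT} (hC : C ∈ ρ.1.lhs) :
    ∀ a ∈ (G.rhsOf ρ C).syms, IsPattern (Sum.elim G.rkN rk a) (expand (linkOf ρ ps) a) := by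
  rintro (C' | σ) ha
  · exact Link.tree_isPattern (linkOf_isPattern hp (G.mem_links_of_mem_rhsOf hC ha))
  · exact init_isPattern (rkα := G.symbolRank) (.inr σ)

theorem expandedRhs_isPattern (hp : Fits ρ ps) {C : G.NT} (hC : C ∈ ρ.1.lhs) :
    IsPattern (G.rkN C) (expandedRhs ρ ps C) :=
  pattern_gsubst (expand_isPattern hp hC) (G.rhsOf_isPattern ρ hC)

theorem decomp_expandedRhs (hp : Fits ρ ps) {C : G.NT} (hC : C ∈ ρ.1.lhs) :
    IsDecomp G.symbolClass (classRank rk) (expandedRhs ρ ps C)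
      ((next ρ ps).2 C).1 (G.decomp (expandedRhs ρ ps C)).2 ∧
    ((next ρ ps).2 C).1.syms.length ≤ shapeBound rk (G.rkN C) ∧
    IsPattern (G.rkN C) ((next ρ ps).2 C).1 := by
  rw [next_apply hC]
  exact decomp_spec (expandedRhs_isPattern hp hC) (G.rkN_le_width C)

theorem piece_component {p : G.Link} {C : G.NT} {ℓ : List ℕ × ShapeLabel rk}
    (h : ℓ ∈ G.Position) : piece ρ ps (G.component p C ℓ) =
      (G.decomp (expandedRhs ρ ps C)).2 ℓ.1 ℓ.2 := by
  rw [component_of_mem h]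
  rfl

theorem mem_next_all {x : G.Component} (hx : x ∈ (next ρ ps).all) :
    ∃ C ∈ ρ.1.lhs, ∃ (ℓ : List ℕ × ShapeLabel rk) (h : ℓ ∈ ((next ρ ps).2 C).1.labels),
      x = some (next ρ ps, C, ⟨ℓ, mem_position h⟩) := by
  obtain ⟨C, hC, hx⟩ := List.mem_flatMap.1 hx
  exact ⟨C, hC, Link.mem_components.1 hx⟩

theorem piece_isPiece (hp : Fits ρ ps) {C : G.NT} (hC : C ∈ ρ.1.lhs)
    {ℓ : List ℕ × ShapeLabel rk} (h : ℓ ∈ ((next ρ ps).2 C).1.labels) :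
    IsPiece G.symbolClass (classRank rk) ℓ.2
      (piece ρ ps (some (next ρ ps, C, ⟨ℓ, mem_position h⟩))) :=
  (decomp_expandedRhs hp hC).1.isPiece ℓ h

/-- The symbols of the new right-hand side. -/
theorem syms_newRhs (hp : Fits ρ ps) :
    ((newRhs ρ ps).flatMap syms).Perm
      ((ρ.1.rhs.flatMap syms).flatMap fun a => (expand (linkOf ρ ps) a).syms) := by
  have h₁ : (newRhs ρ ps).flatMap syms = ρ.1.lhs.flatMap fun C =>
      ((next ρ ps).2 C).1.labels.flatMap fun ℓ =>
        ((G.decomp (expandedRhs ρ ps C)).2 ℓ.1 ℓ.2).syms := by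
    simp only [newRhs, Link.all, Link.components, List.flatMap_map, List.flatMap_assoc]
    refine List.flatMap_congr fun C hC => List.flatMap_congr fun ℓ hℓ => ?_
    rw [piece_component (mem_position hℓ)]
  rw [h₁, ← G.map_rhsOf ρ, List.flatMap_map, List.flatMap_assoc]
  refine List.Perm.flatMap_congr fun C hC => ?_
  have hd := (decomp_expandedRhs hp hC).1
  have h₂ := syms_psubst fun ℓ hℓ => (hd.isPiece ℓ hℓ).isPattern
  rw [hd.psubst_eq] at h₂
  exact h₂.symm.trans (syms_gsubst (expand_isPattern hp hC))

/-- Decomposition neither loses nor duplicates symbols. Hence nonterminals stay unique in the new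
right-hand side and are partitioned by the new links. -/
theorem nonterminals_newRhs (hp : Fits ρ ps) :
    (nonterminals (newRhs ρ ps)).Perm
      ((nonterminals ρ.1.rhs).flatMap fun C => (linkOf ρ ps C).components C) := by
  refine ((syms_newRhs hp).filterMap _).trans ?_
  unfold nonterminals
  generalize ρ.1.rhs.flatMap syms = l
  induction l with
  | nil => exact .refl _
  | cons a l ih =>
    rcases a with C | σ
    · simp only [List.flatMap_cons, List.filterMap_append, List.filterMap_cons, Sum.getLeft?_inl]
      refine List.Perm.append ?_ ih
      refine ((Link.syms_tree _ C).filterMap _).trans ?_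
      simp [List.filterMap_map, Function.comp_def]
    · have h : (expand (linkOf ρ ps) (.inr σ)).syms = [.inr σ] := syms_init _
      rw [List.flatMap_cons, h]
      exact ih

theorem mem_terminals_newRhs (hp : Fits ρ ps) {σ : T} (h : σ ∈ terminals ρ.1.rhs) :
    σ ∈ terminals (newRhs ρ ps) := by
  rw [terminals, List.mem_filterMap] at h ⊢
  obtain ⟨a, ha, he⟩ := h
  rw [Sum.getRight?_eq_some_iff] at he
  subst he
  have h : (expand (linkOf ρ ps) (.inr σ)).syms = [.inr σ] := syms_init _
  exact ⟨.inr σ, (syms_newRhs hp).mem_iff.2 (List.mem_flatMap.2 ⟨_, ha, by simp [h]⟩), rfl⟩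

theorem mem_components_of_mem_piece (hp : Fits ρ ps) {x y : G.Component}
    (hx : x ∈ (next ρ ps).all) (hy : .inl y ∈ (piece ρ ps x).syms) :
    ∃ C ∈ ρ.1.links.flatten, y ∈ (linkOf ρ ps C).components C := by
  have h : y ∈ nonterminals (newRhs ρ ps) :=
    mem_nonterminals.2 ⟨_, List.mem_map_of_mem hx, hy⟩
  rw [(nonterminals_newRhs hp).mem_iff, List.mem_flatMap] at h
  obtain ⟨C, hC, h⟩ := h
  exact ⟨C, (G.mem_links _ ρ.2 C).2 hC, h⟩

theorem piece_isPattern (hp : Fits ρ ps) {x : G.Component} (hx : x ∈ (next ρ ps).all) :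
    IsPattern (G.componentRank x) (piece ρ ps x) := by
  obtain ⟨C, hC, ℓ, h, rfl⟩ := mem_next_all hx
  exact (piece_isPiece hp hC h).isPattern

theorem subst_piece_isPattern (hp : Fits ρ ps) {g : G.Component → RTerm rk ℕ}
    (hg : ∀ C ∈ ρ.1.links.flatten, ∀ x ∈ (linkOf ρ ps C).components C,
      IsPattern (G.componentRank x) (g x)) {x : G.Component} (hx : x ∈ (next ρ ps).all) :
    IsPattern (G.componentRank x) (subst g (piece ρ ps x)) := by
  refine pattern_subst (fun y hy => ?_) (piece_isPattern hp hx)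
  obtain ⟨C, hC, hy⟩ := mem_components_of_mem_piece hp hx hy
  exact hg C hC y hy

/-- The new right-hand side generates the components of what the old one generates. -/
theorem subst_tree_next (hp : Fits ρ ps) {f : G.NT → RTerm rk ℕ} {g : G.Component → RTerm rk ℕ}
    (hfg : ∀ C ∈ ρ.1.links.flatten, subst g ((linkOf ρ ps C).tree C) = f C)
    (hg : ∀ C ∈ ρ.1.links.flatten, ∀ x ∈ (linkOf ρ ps C).components C,
      IsPattern (G.componentRank x) (g x)) {C : G.NT} (hC : C ∈ ρ.1.lhs)
    {g' : G.Component → RTerm rk ℕ}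
    (hg' : ∀ x ∈ (next ρ ps).all, g' x = subst g (piece ρ ps x)) :
    subst g' ((next ρ ps).tree C) = subst f (G.rhsOf ρ C) := by
  have hall : ∀ ℓ ∈ ((next ρ ps).2 C).1.labels, G.component (next ρ ps) C ℓ ∈ (next ρ ps).all :=
    fun ℓ hℓ => List.mem_flatMap.2 ⟨C, hC, List.mem_map_of_mem hℓ⟩
  have hpat : ∀ ℓ ∈ ((next ρ ps).2 C).1.labels,
      IsPattern (G.componentRank (G.component (next ρ ps) C ℓ))
        (g' (G.component (next ρ ps) C ℓ)) := fun ℓ hℓ => by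
    rw [hg' _ (hall ℓ hℓ)]
    exact subst_piece_isPattern hp hg (hall ℓ hℓ)
  have hbound : ∀ C ∈ ρ.1.links.flatten, ∀ a : G.Component ⊕ T,
      a ∈ ((linkOf ρ ps C).tree C).syms →
      ∀ y ∈ (Sum.elim g (init rk) a : RTerm rk ℕ).vars, y < G.symbolRank a := by
    intro C hC a ha
    rw [(Link.syms_tree _ C).mem_iff, List.mem_map] at ha
    obtain ⟨x, hx, rfl⟩ := ha
    exact (hg C hC x hx).lt
  have hd := (decomp_expandedRhs hp hC).1
  -- Interpret the components at the nodes of the shape; insert the pieces; pull `subst g` out by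
  -- associativity, so that the pieces reassemble to the expanded right-hand side; finally push it
  -- in again to evaluate the shapes of the links.
  calc subst g' ((next ρ ps).tree C)
      = ((next ρ ps).2 C).1.psubst fun q b => g' (G.component (next ρ ps) C (q, b)) := by
        rw [subst_eq_gsubst, Link.tree, gsubst_psubst]
        · refine psubst_congr fun ℓ hℓ => ?_
          exact gsubst_init (rkβ := G.symbolRank) _ _ (hpat ℓ hℓ).lt
        · intro ℓ hℓ a ha
          rw [syms_init, List.mem_singleton] at ha
          subst ha
          exact (hpat ℓ hℓ).lt
    _ = ((next ρ ps).2 C).1.psubst fun q b =>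
          subst g ((G.decomp (expandedRhs ρ ps C)).2 q b) := by
        refine psubst_congr fun ℓ hℓ => ?_
        rw [hg' _ (hall ℓ hℓ), piece_component (mem_position hℓ)]
    _ = subst g (expandedRhs ρ ps C) := by
        conv_rhs => rw [← hd.psubst_eq, subst_eq_gsubst]
        simp only [subst_eq_gsubst]
        refine (gsubst_psubst ?_).symm
        · rintro ℓ hℓ (y | σ) ha
          · rw [← piece_component (p := next ρ ps) (mem_position hℓ)] at ha
            obtain ⟨C', hC', hy⟩ := mem_components_of_mem_piece hp (hall ℓ hℓ) ha
            exact (hg C' hC' y hy).lt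
          · exact (init_isPattern σ).lt
    _ = subst f (G.rhsOf ρ C) := by
        rw [subst_eq_gsubst, subst_eq_gsubst, expandedRhs]
        refine (gsubst_psubst ?_).trans (gsubst_congr ?_)
        rotate_left
        · rintro (C' | σ) ha
          · have := hfg C' (G.mem_links_of_mem_rhsOf hC ha)
            rwa [subst_eq_gsubst] at this
          · exact gsubst_init (rkβ := G.symbolRank) _ _ (init_isPattern σ).lt
        · rintro ⟨q, C' | σ⟩ hℓ a ha
          · exact hbound C' (G.mem_links_of_mem_rhsOf hC (mem_syms_of_mem_labels hℓ)) a ha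
          · have h : (expand (linkOf ρ ps) (.inr σ)).syms = [.inr σ] := syms_init _
            have ha : a ∈ (expand (linkOf ρ ps) (.inr σ)).syms := ha
            rw [h, List.mem_singleton] at ha
            subst ha
            exact (init_isPattern σ).lt

/-- The root of a piece has the right class; if it is a component and not a terminal, its value has
a root of that class by hypothesis. -/
theorem root_subst_piece (hp : Fits ρ ps) {g : G.Component → RTerm rk ℕ}
    (hg : ∀ C ∈ ρ.1.links.flatten, ∀ x ∈ (linkOf ρ ps C).components C,
      ∃ σ, (g x).root = some σ ∧ Fintype.equivFin T σ = G.symbolClass (.inl x))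
    {x : G.Component} (hx : x ∈ (next ρ ps).all) :
    ∃ σ, (subst g (piece ρ ps x)).root = some σ ∧
      Fintype.equivFin T σ = G.symbolClass (.inl x) := by
  have hpi : ∃ a, (piece ρ ps x).root = some a ∧ G.symbolClass a = G.symbolClass (.inl x) := by
    obtain ⟨C, hC, ℓ, h, rfl⟩ := mem_next_all hx
    exact (piece_isPiece hp hC h).root
  have hmem := fun y => mem_components_of_mem_piece (y := y) hp hx
  obtain ⟨a, ha, hcl⟩ := hpi
  rw [← hcl]
  revert hmem ha
  generalize piece ρ ps x = t
  intro hmem ha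
  rcases t with v | ⟨b, ts⟩
  · simp [root] at ha
  · obtain rfl : b = a := by simpa [root] using ha
    rcases b with y | σ
    · obtain ⟨C, hC, hy⟩ := hmem y (mem_syms_node.2 (.inl rfl))
      obtain ⟨σ, h₁, h₂⟩ := hg C hC y hy
      exact ⟨σ, root_bind h₁ _, h₂⟩
    · exact ⟨σ, rfl, rfl⟩

end

end MCFTG

end TreeGrammar

namespace TreeGrammar

open RTerm

namespace MCFTG

variable {T : Type*} [Fintype T] {rk : T → ℕ} {G : MCFTG rk}

/-! ## Interpretation of the components -/

/-- `f` gives the patterns generated by the nonterminals in `p`, and `g` gives their pieces. -/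
structure Interp (p : G.Link) (f : G.NT → RTerm rk ℕ) (g : G.Component → RTerm rk ℕ) : Prop where
  tree_eq : ∀ C ∈ p.1.1, subst g (p.tree C) = f C
  pattern : ∀ x ∈ p.all, IsPattern (G.componentRank x) (g x)
  root : ∀ x ∈ p.all, ∃ σ, (g x).root = some σ ∧
    Fintype.equivFin T σ = G.symbolClass (.inl x)

theorem Interp.congr {p : G.Link} {f f' : G.NT → RTerm rk ℕ} {g g' : G.Component → RTerm rk ℕ}
    (h : Interp p f g) (hf : ∀ C ∈ p.1.1, f' C = f C) (hg : ∀ x ∈ p.all, g' x = g x) :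
    Interp p f' g' where
  tree_eq C hC := by
    rw [hf C hC, ← h.tree_eq C hC]
    refine subst_congr fun x hx => hg x (List.mem_flatMap.2 ⟨C, hC, ?_⟩)
    simpa using (Link.syms_tree p C).mem_iff.1 hx
  pattern x hx := hg x hx ▸ h.pattern x hx
  root x hx := hg x hx ▸ h.root x hx

theorem Fits.eq_of_mem_all {ρ : G.R} {ps : Fin (G.ruleRank ρ) → G.Link} (hp : Fits ρ ps)
    {i j : Fin (G.ruleRank ρ)} {x : G.Component} (hi : x ∈ (ps i).all) (hj : x ∈ (ps j).all) :
    i = j := by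
  have h := Link.eq_of_mem_all hi hj
  obtain ⟨C, hC, -⟩ := List.mem_flatMap.1 hi
  refine get_unique (G.links_nodup _ ρ.2) (C := C) ?_ ?_
  · rw [← (hp i).1]; exact hC
  · rw [← (hp j).1, ← h]; exact hC

/-- Distinct links share neither old nonterminals nor components, so the interpretations of the
children combine without conflict. -/
theorem Interp.glue {ρ : G.R} {ps : Fin (G.ruleRank ρ) → G.Link} (hp : Fits ρ ps)
    {fs : Fin (G.ruleRank ρ) → G.NT → RTerm rk ℕ}
    {gs : Fin (G.ruleRank ρ) → G.Component → RTerm rk ℕ}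
    (h : ∀ i, Interp (ps i) (fs i) (gs i)) :
    ∃ f g, (∀ i, ∀ C ∈ ρ.1.links.get i, f C = fs i C) ∧ (∀ i, ∀ x ∈ (ps i).all, g x = gs i x) ∧
      ∀ i, Interp (ps i) f g := by
  classical
  set f := combine ρ.1.links fs fun _ => var 0
  set g : G.Component → RTerm rk ℕ := fun x =>
    if h : ∃ i, x ∈ (ps i).all then gs h.choose x else var 0
  have hf : ∀ i, ∀ C ∈ ρ.1.links.get i, f C = fs i C := fun i C hC =>
    combine_eq (G.links_nodup _ ρ.2) _ _ hC
  have hg : ∀ i, ∀ x ∈ (ps i).all, g x = gs i x := fun i x hx => by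
    have h : ∃ i, x ∈ (ps i).all := ⟨i, hx⟩
    simp only [g, dif_pos h]
    rw [hp.eq_of_mem_all h.choose_spec hx]
  exact ⟨f, g, hf, hg, fun i => (h i).congr (fun C hC => hf i C ((hp i).1 ▸ hC)) (hg i)⟩

theorem mem_all_of_mem_components {ρ : G.R} {ps : Fin (G.ruleRank ρ) → G.Link} (hp : Fits ρ ps)
    {i : Fin (G.ruleRank ρ)} {C : G.NT} (hC : C ∈ ρ.1.links.get i) {x : G.Component}
    (hx : x ∈ (linkOf ρ ps C).components C) : x ∈ (ps i).all := by
  rw [linkOf_eq hC] at hx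
  exact List.mem_flatMap.2 ⟨C, (hp i).1 ▸ hC, hx⟩

/-- The inductive step of all correctness proofs: one rule application, done simultaneously in both
grammars. -/
theorem Interp.next {ρ : G.R} {ps : Fin (G.ruleRank ρ) → G.Link} (hp : Fits ρ ps)
    {f : G.NT → RTerm rk ℕ} {g : G.Component → RTerm rk ℕ} (h : ∀ i, Interp (ps i) f g) :
    Interp (next ρ ps) (fun C => subst f (G.rhsOf ρ C)) fun x => subst g (piece ρ ps x) := by
  have h₁ : ∀ C ∈ ρ.1.links.flatten, ∀ x ∈ (linkOf ρ ps C).components C,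
      ∃ i, x ∈ (ps i).all := fun C hC x hx => by
    obtain ⟨i, hi⟩ := mem_flatten_iff_get.1 hC
    exact ⟨i, mem_all_of_mem_components hp hi hx⟩
  have h₂ : ∀ C ∈ ρ.1.links.flatten, ∀ x ∈ (linkOf ρ ps C).components C,
      IsPattern (G.componentRank x) (g x) := fun C hC x hx => by
    obtain ⟨i, hi⟩ := h₁ C hC x hx
    exact (h i).pattern x hi
  refine ⟨fun C hC => subst_tree_next hp (fun C' hC' => ?_) h₂ hC fun _ _ => rfl,
    fun x hx => subst_piece_isPattern hp h₂ hx,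
    fun x hx => root_subst_piece hp (fun C hC x hx => ?_) hx⟩
  · obtain ⟨i, hi⟩ := mem_flatten_iff_get.1 hC'
    rw [linkOf_eq hi]
    exact (h i).tree_eq C' ((hp i).1 ▸ hi)
  · obtain ⟨i, hi⟩ := h₁ C hC x hx
    exact (h i).root x hi

/-! ## The shapes of a derivation tree -/

/-- The shapes that correspond to the value of a derivation tree. -/
noncomputable def linkOfTree : RTree G.ruleRank → G.Link
  | var e => e.elim
  | node ρ ds => next ρ fun i => linkOfTree (ds i)

/-- The bound uses the rank of each `C`, not the width: rank 0 then forces a single piece, as needed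
for the initial nonterminal. -/
structure Link.IsGood (p : G.Link) : Prop where
  pattern : ∀ C ∈ p.1.1, IsPattern (G.rkN C) (p.2 C).1
  length_le : ∀ C ∈ p.1.1, (p.2 C).1.syms.length ≤ shapeBound rk (G.rkN C)

theorem next_isGood {ρ : G.R} {ps : Fin (G.ruleRank ρ) → G.Link} (hp : Fits ρ ps) :
    (next ρ ps).IsGood :=
  ⟨fun _ hC => (decomp_expandedRhs hp hC).2.2, fun _ hC => (decomp_expandedRhs hp hC).2.1⟩

theorem Der.linkOfTree {A : List G.NT} {d : RTree G.ruleRank} (h : G.Der A d) :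
    (linkOfTree d).1.1 = A ∧ (linkOfTree d).IsGood := by
  induction d generalizing A with
  | var e => exact e.elim
  | node ρ ds ih =>
    obtain ⟨rfl, hd⟩ := G.der_node.1 h
    exact ⟨rfl, next_isGood fun i => ⟨(ih i (hd i)).1, (ih i (hd i)).2.pattern⟩⟩

/-- The links `ps` of `ρ` are those of derivation trees. -/
def Realized (ρ : G.R) (ps : Fin (G.ruleRank ρ) → G.Link) : Prop :=
  ∀ i, ∃ d, G.Der (ρ.1.links.get i) d ∧ linkOfTree d = ps i

theorem Realized.isGood {ρ : G.R} {ps : Fin (G.ruleRank ρ) → G.Link} (h : Realized ρ ps)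
    (i : Fin (G.ruleRank ρ)) : (ps i).1.1 = ρ.1.links.get i ∧ (ps i).IsGood := by
  obtain ⟨d, hd, e⟩ := h i
  exact e ▸ hd.linkOfTree

theorem Realized.fits {ρ : G.R} {ps : Fin (G.ruleRank ρ) → G.Link} (h : Realized ρ ps) :
    Fits ρ ps :=
  fun i => ⟨(h.isGood i).1, (h.isGood i).2.pattern⟩

theorem Der.realized {A : List G.NT} {ρ : G.R} {ds : Fin (G.ruleRank ρ) → RTree G.ruleRank}
    (h : G.Der A (node ρ ds)) : Realized ρ fun i => MCFTG.linkOfTree (ds i) :=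
  fun i => ⟨ds i, (G.der_node.1 h).2 i, rfl⟩

theorem Realized.exists_der {ρ : G.R} {ps : Fin (G.ruleRank ρ) → G.Link} (h : Realized ρ ps) :
    ∃ d, G.Der ρ.1.lhs d ∧ linkOfTree d = next ρ ps := by
  choose ds hd hps using h
  refine ⟨node ρ ds, G.der_node.2 ⟨rfl, hd⟩, ?_⟩
  simp only [MCFTG.linkOfTree, hps]

theorem Der.exists_interp {A : List G.NT} {d : RTree G.ruleRank} (h : G.Der A d) :
    ∃ f g, G.val d = A.map f ∧ Interp (MCFTG.linkOfTree d) f g := by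
  induction d generalizing A with
  | var e => exact e.elim
  | node ρ ds ih =>
    have hr := h.realized
    obtain ⟨rfl, hd⟩ := G.der_node.1 h
    choose fs gs hv hi using fun i => ih i (hd i)
    obtain ⟨f, g, hf, hg, hfg⟩ := Interp.glue hr.fits hi
    refine ⟨_, _, ?_, Interp.next hr.fits hfg⟩
    rw [G.val_node (f := f) fun i => (hv i).trans (List.map_congr_left fun C hC => (hf i C hC).symm),
      ← G.map_rhsOf ρ, List.map_map]
    rfl

theorem shape_of_rank_zero {β : Type*} {rkβ : β → ℕ} {D : RTerm rkβ ℕ} (h : IsPattern 0 D)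
    (hl : D.syms.length ≤ 1) : ∃ b ts, D = node b ts ∧ rkβ b = 0 := by
  have h : D.vars = [] := by simpa [IsPattern] using h
  rcases D with x | ⟨b, ts⟩
  · simp [vars] at h
  · refine ⟨b, ts, rfl, ?_⟩
    by_contra h0
    have hs : (List.ofFn fun i => (ts i).syms).flatten = [] := by
      rw [syms, List.length_cons] at hl
      exact List.eq_nil_of_length_eq_zero (by omega)
    let i : Fin (rkβ b) := ⟨0, Nat.pos_of_ne_zero h0⟩
    have h₁ : (ts i).syms = [] :=
      (List.flatten_eq_nil_iff.1 hs) _ (List.mem_ofFn.2 ⟨i, rfl⟩)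
    have h₂ : (ts i).vars = [] := List.sublist_nil.1 (h ▸ vars_sublist_node ts i)
    revert h₁ h₂
    cases ts i <;> simp [syms, vars]

theorem Link.IsGood.rank_zero {p : G.Link} (hp : p.IsGood) {C : G.NT} (hC : C ∈ p.1.1)
    (h0 : G.rkN C = 0) : ∃ x, p.components C = [x] ∧ G.componentRank x = 0 ∧
      ∀ g : G.Component → RTerm rk ℕ, subst g (p.tree C) = g x := by
  obtain ⟨b, ts, hD, hb⟩ := shape_of_rank_zero (h0 ▸ hp.pattern C hC)
    (by simpa [h0, shapeBound] using hp.length_le C hC)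
  have hi : ∀ i : Fin (labelRank rk b), False := fun i => Nat.not_lt_zero i.1 (hb ▸ i.2)
  have hl : (p.2 C).1.labels = [([], b)] := by
    rw [hD, labels]
    congr 1
    rw [List.flatten_eq_nil_iff]
    simp only [List.mem_ofFn]
    rintro _ ⟨i, -⟩
    exact (hi i).elim
  have hpos : ([], b) ∈ G.Position := mem_position (D := p.2 C) (by simp [hl])
  have hx : G.componentRank (G.component p C ([], b)) = 0 := by
    rw [component_of_mem hpos]
    exact hb
  refine ⟨G.component p C ([], b), by rw [Link.components, hl]; rfl, hx, fun g => ?_⟩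
  have ht : p.tree C = init G.symbolRank (.inl (G.component p C ([], b))) := by
    rw [Link.tree, hD, psubst]
    refine bind_eq_self fun i _ => ?_
    rw [dif_neg]
    rw [hb]
    exact Nat.not_lt_zero i
  rw [ht, init, subst]
  refine bind_eq_self fun i _ => ?_
  rw [dif_neg]
  rw [hx]
  exact Nat.not_lt_zero i

/-- There is exactly one component, of rank 0, so the left-hand side of the new rule may be replaced
by the new initial nonterminal. -/
theorem all_eq_of_start {ρ : G.R} {ps : Fin (G.ruleRank ρ) → G.Link} (hp : Fits ρ ps)
    (hs : ρ.1.lhs = [G.start]) : ∃ x, (next ρ ps).all = [x] ∧ G.componentRank x = 0 ∧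
      ∀ g : G.Component → RTerm rk ℕ, subst g ((next ρ ps).tree G.start) = g x := by
  have hmem : G.start ∈ (next ρ ps).1.1 := by
    change G.start ∈ ρ.1.lhs
    simp [hs]
  obtain ⟨x, h₁, h₂, h₃⟩ := (next_isGood hp).rank_zero hmem G.start_rank
  refine ⟨x, ?_, h₂, h₃⟩
  have : (next ρ ps).1.1 = [G.start] := hs
  rw [Link.all, this]
  simp [h₁]

/-! ## The new grammar -/

open Classical in
/-- The links of a new rule. -/
noncomputable def newLinks (ρ : G.R) (ps : Fin (G.ruleRank ρ) → G.Link) :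
    List (List G.Component) :=
  -- A link without components cannot be a big nonterminal and is dropped. Listing a finite set
  -- makes the order depend only on the set of links.
  ((Finset.univ.image fun i => (ps i).all).erase []).toList

theorem mem_newLinks {ρ : G.R} {ps : Fin (G.ruleRank ρ) → G.Link} {B : List G.Component} :
    B ∈ newLinks ρ ps ↔ B ≠ [] ∧ ∃ i, (ps i).all = B := by
  simp [newLinks]

/-- The new rule given by `ρ` and `ps`; its left-hand side is the new initial nonterminal if `b` is
true. -/
noncomputable def newRule (ρ : G.R) (ps : Fin (G.ruleRank ρ) → G.Link) (b : Bool) :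
    Rule G.componentRank rk where
  lhs := if b then [none] else (next ρ ps).all
  rhs := newRhs ρ ps
  links := newLinks ρ ps

/-- The conditions under which `newRule ρ ps b` is a rule. -/
structure Admissible (ρ : G.R) (ps : Fin (G.ruleRank ρ) → G.Link) (b : Bool) : Prop where
  realized : Realized ρ ps
  initial : b = true → ρ.1.lhs = [G.start]
  ne_nil : (next ρ ps).all ≠ []
  -- In the start-separated case no noninitial copy of an initial rule is made: a terminal initial
  -- rule may lack symbols of `Δ`, and its noninitial copy would have to be lexicalized.
  noninitial : b = false → ¬ (G.StartSeparated ∧ ρ.1.lhs = [G.start])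

theorem finite_newRules (G : MCFTG rk) :
    {r | ∃ (ρ : G.R) (ps : Fin (G.ruleRank ρ) → G.Link) (b : Bool),
      Admissible ρ ps b ∧ newRule ρ ps b = r}.Finite := by
  refine (Set.finite_range fun x : (Σ ρ : G.R, Fin (G.ruleRank ρ) → G.Link) × Bool =>
    newRule x.1.1 x.1.2 x.2).subset ?_
  rintro _ ⟨ρ, ps, b, -, rfl⟩
  exact ⟨(⟨ρ, ps⟩, b), rfl⟩

theorem finite_newBig (G : MCFTG rk) :
    {B | B = [none] ∨ ∃ p : G.Link, p.IsGood ∧ p.all ≠ [] ∧ p.all = B}.Finite := by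
  refine ((Set.finite_singleton [none]).union
    (Set.finite_range fun p : G.Link => p.all)).subset ?_
  rintro B (rfl | ⟨p, -, -, rfl⟩)
  exacts [.inl rfl, .inr ⟨p, rfl⟩]

theorem flatten_newLinks_nodup {ρ : G.R} {ps : Fin (G.ruleRank ρ) → G.Link} :
    (newLinks ρ ps).flatten.Nodup := by
  rw [List.nodup_flatten]
  refine ⟨fun B hB => ?_, ?_⟩
  · obtain ⟨-, i, rfl⟩ := mem_newLinks.1 hB
    exact (ps i).all_nodup
  · refine List.Pairwise.imp_of_mem (fun {B B'} hB hB' hne x hx hx' => ?_)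
      (Finset.nodup_toList _)
    obtain ⟨-, i, rfl⟩ := mem_newLinks.1 hB
    obtain ⟨-, j, rfl⟩ := mem_newLinks.1 hB'
    exact hne (congrArg Link.all (Link.eq_of_mem_all hx hx'))

theorem mem_flatten_newLinks {ρ : G.R} {ps : Fin (G.ruleRank ρ) → G.Link} {x : G.Component} :
    x ∈ (newLinks ρ ps).flatten ↔ ∃ i, x ∈ (ps i).all := by
  rw [List.mem_flatten]
  constructor
  · rintro ⟨B, hB, hx⟩
    obtain ⟨-, i, rfl⟩ := mem_newLinks.1 hB
    exact ⟨i, hx⟩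
  · rintro ⟨i, hx⟩
    exact ⟨_, mem_newLinks.2 ⟨List.ne_nil_of_mem hx, i, rfl⟩, hx⟩

theorem mem_newLinks_iff_nonterminals {ρ : G.R} {ps : Fin (G.ruleRank ρ) → G.Link}
    (hp : Fits ρ ps) {x : G.Component} :
    x ∈ (newLinks ρ ps).flatten ↔ x ∈ nonterminals (newRhs ρ ps) := by
  rw [mem_flatten_newLinks, (nonterminals_newRhs hp).mem_iff, List.mem_flatMap]
  constructor
  · rintro ⟨i, hx⟩
    obtain ⟨C, hC, hx⟩ := List.mem_flatMap.1 hx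
    rw [(hp i).1] at hC
    refine ⟨C, (G.mem_links _ ρ.2 C).1 (mem_flatten_iff_get.2 ⟨i, hC⟩), ?_⟩
    rwa [linkOf_eq hC]
  · rintro ⟨C, hC, hx⟩
    obtain ⟨i, hi⟩ := mem_flatten_iff_get.1 ((G.mem_links _ ρ.2 C).2 hC)
    exact ⟨i, mem_all_of_mem_components hp hi hx⟩

variable (G)

/-- The MC-TAG that is equivalent to `G`. -/
noncomputable def newGrammar : MCFTG rk where
  NT := G.Component
  fintypeNT := Fintype.ofFinite _
  rkN := G.componentRank
  big := G.finite_newBig.toFinset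
  big_ne_nil A hA := by
    rcases (Set.Finite.mem_toFinset _).1 hA with rfl | ⟨p, -, h, rfl⟩
    exacts [by simp, h]
  big_nodup A hA := by
    rcases (Set.Finite.mem_toFinset _).1 hA with rfl | ⟨p, -, -, rfl⟩
    exacts [by simp, p.all_nodup]
  big_inj A hA B hB h := by
    rcases (Set.Finite.mem_toFinset _).1 hA with rfl | ⟨p, -, hp, rfl⟩
    · rcases (Set.Finite.mem_toFinset _).1 hB with rfl | ⟨p', -, hp', rfl⟩
      · rfl
      · exact (p'.none_notMem_all ((h none).1 (by simp))).elim
    · rcases (Set.Finite.mem_toFinset _).1 hB with rfl | ⟨p', -, hp', rfl⟩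
      · exact (p.none_notMem_all ((h none).2 (by simp))).elim
      -- A common component already determines the link.
      · obtain ⟨x, hx⟩ := List.exists_mem_of_ne_nil _ hp
        rw [Link.eq_of_mem_all hx ((h x).1 hx)]
  exists_pos_rank := G.exists_pos_rank
  start := none
  start_mem := (Set.Finite.mem_toFinset _).2 (.inl rfl)
  start_rank := rfl
  rules := G.finite_newRules.toFinset
  lhs_mem r hr := by
    obtain ⟨ρ, ps, b, h, rfl⟩ := (Set.Finite.mem_toFinset _).1 hr
    rw [Set.Finite.mem_toFinset]
    cases b
    · exact .inr ⟨_, next_isGood h.realized.fits, h.ne_nil, rfl⟩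
    · exact .inl rfl
  rhs_rank r hr := by
    obtain ⟨ρ, ps, b, h, rfl⟩ := (Set.Finite.mem_toFinset _).1 hr
    have hp := h.realized.fits
    cases b
    · simp only [newRule, newRhs, Bool.false_eq_true, if_false]
      rw [List.forall₂_map_right_iff, List.forall₂_same]
      exact fun x hx => piece_isPattern hp hx
    · obtain ⟨x, hx, h0, -⟩ := all_eq_of_start hp (h.initial rfl)
      simp only [newRule, newRhs, hx, if_true, List.map_cons, List.map_nil]
      refine .cons ?_ .nil
      have := piece_isPattern hp (x := x) (by simp [hx])
      rwa [h0] at this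
  rhs_unique r hr := by
    obtain ⟨ρ, ps, b, h, rfl⟩ := (Set.Finite.mem_toFinset _).1 hr
    exact (nonterminals_newRhs h.realized.fits).nodup_iff.2
      (nodup_flatMap_components (G.rhs_unique _ ρ.2) _)
  links_mem r hr B hB := by
    obtain ⟨ρ, ps, b, h, rfl⟩ := (Set.Finite.mem_toFinset _).1 hr
    obtain ⟨hne, i, rfl⟩ := mem_newLinks.1 hB
    exact (Set.Finite.mem_toFinset _).2 (.inr ⟨_, (h.realized.isGood i).2, hne, rfl⟩)
  links_nodup r hr := by
    obtain ⟨ρ, ps, b, h, rfl⟩ := (Set.Finite.mem_toFinset _).1 hr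
    exact flatten_newLinks_nodup
  mem_links r hr x := by
    obtain ⟨ρ, ps, b, h, rfl⟩ := (Set.Finite.mem_toFinset _).1 hr
    exact mem_newLinks_iff_nonterminals h.realized.fits
  links_order r hr r' hr' h₁ h₂ h₃ := by
    obtain ⟨ρ, ps, b, h, rfl⟩ := (Set.Finite.mem_toFinset _).1 hr
    obtain ⟨ρ', ps', b', h', rfl⟩ := (Set.Finite.mem_toFinset _).1 hr'
    have : newLinks ρ ps = newLinks ρ' ps' := by
      refine congrArg Finset.toList (Finset.ext fun B => ?_)
      rw [← Finset.mem_toList, ← Finset.mem_toList]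
      exact h₃.mem_iff
    unfold newRule at *
    simp_all

theorem mem_newGrammar_rules {r : Rule G.componentRank rk} : r ∈ G.newGrammar.rules ↔
    ∃ (ρ : G.R) (ps : Fin (G.ruleRank ρ) → G.Link) (b : Bool),
      Admissible ρ ps b ∧ newRule ρ ps b = r :=
  Set.Finite.mem_toFinset _

theorem newGrammar_startSeparated : G.newGrammar.StartSeparated := by
  intro r hr h
  obtain ⟨ρ, ps, b, ha, rfl⟩ := G.mem_newGrammar_rules.1 hr
  have h : none ∈ nonterminals (newRhs ρ ps) := h
  rw [← mem_newLinks_iff_nonterminals ha.realized.fits, mem_flatten_newLinks] at h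
  obtain ⟨i, hi⟩ := h
  exact (ps i).none_notMem_all hi

/-- New right-hand sides keep the terminals of the old ones. Only an initial terminal rule may lack
a symbol of `Δ`, and its sole copy is again initial and terminal. -/
theorem newGrammar_isLexicalized (hs : G.StartSeparated) {Δ : Set T} (hΔ : G.IsLexicalized Δ) :
    G.newGrammar.IsLexicalized Δ := by
  intro r hr hproper
  obtain ⟨ρ, ps, b, ha, rfl⟩ := G.mem_newGrammar_rules.1 hr
  have hp := ha.realized.fits
  obtain ⟨σ, hσ, h⟩ := hΔ ρ.1 ρ.2 fun h => hproper (by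
    cases b
    · exact (ha.noninitial rfl ⟨hs, h.1⟩).elim
    · refine ⟨rfl, ?_⟩
      have := nonterminals_newRhs hp
      rw [h.2] at this
      exact this.eq_nil)
  exact ⟨σ, hσ, mem_terminals_newRhs hp h⟩

theorem Link.IsGood.length_all_le {p : G.Link} (hp : p.IsGood) :
    p.all.length ≤ G.multiplicity * shapeBound rk G.width := by
  have h₁ : p.1.1.length ≤ G.multiplicity := Finset.le_sup (f := List.length) p.1.2
  have h₂ : ∀ l ∈ p.1.1.map fun C => (p.components C).length, l ≤ shapeBound rk G.width := by
    intro l hl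
    obtain ⟨C, hC, rfl⟩ := List.mem_map.1 hl
    rw [components, List.length_map, labels_length]
    exact (hp.length_le C hC).trans (shapeBound_mono G.exists_pos_rank (G.rkN_le_width C))
  rw [all, List.length_flatMap]
  refine (List.sum_le_card_nsmul _ _ h₂).trans ?_
  rw [List.length_map, smul_eq_mul]
  exact Nat.mul_le_mul_right _ h₁

theorem newGrammar_multiplicity_le :
    G.newGrammar.multiplicity ≤ G.multiplicity * shapeBound rk G.width := by
  refine Finset.sup_le fun B hB => ?_
  rcases (Set.Finite.mem_toFinset _).1 hB with rfl | ⟨p, hp, -, rfl⟩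
  · have h₁ : 1 ≤ G.multiplicity := Finset.le_sup (f := List.length) G.start_mem
    have h₂ : 1 ≤ shapeBound rk G.width :=
      le_trans (by simp [shapeBound]) (shapeBound_mono G.exists_pos_rank (Nat.zero_le _))
    exact Nat.mul_le_mul h₁ h₂
  · exact hp.length_all_le

/-! ### The new grammar is an MC-TAG -/

/-- The root labels of the generated trees. -/
def rootLabels : Set T := {σ | ∃ t ∈ G.treeLanguage, t.root = some σ}

open Classical in
/-- Identifies the root labels of the generated trees. -/
noncomputable def collapse (σ : T) : Option T := if σ ∈ G.rootLabels then none else some σ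

-- The equivalence relation is the kernel of this map. If the language is nonempty, the initial
-- nonterminal joins the root labels; if it is empty, any class will do, as there are then no
-- initial rules.
open Classical in
noncomputable def symbolKey (a : G.Component ⊕ T) : Option T :=
  if a = .inl none ∧ G.rootLabels.Nonempty then none
  else G.collapse ((Fintype.equivFin T).symm (G.symbolClass a))

variable {G}

theorem symbolKey_eq {a : G.Component ⊕ T} (h : a ≠ .inl none) :
    G.symbolKey a = G.collapse ((Fintype.equivFin T).symm (G.symbolClass a)) := by
  rw [symbolKey, if_neg fun h' => h h'.1]

theorem symbolKey_inr (σ : T) : G.symbolKey (.inr σ) = G.collapse σ := by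
  rw [symbolKey_eq (by simp)]
  simp [symbolClass]

theorem ne_none_of_mem_piece {ρ : G.R} {ps : Fin (G.ruleRank ρ) → G.Link} (hp : Fits ρ ps)
    {x : G.Component} (hx : x ∈ (next ρ ps).all) {a : G.Component ⊕ T}
    (ha : a ∈ (piece ρ ps x).syms) : a ≠ .inl none := by
  rintro rfl
  obtain ⟨C, hC, h⟩ := mem_components_of_mem_piece hp hx ha
  obtain ⟨_, _, h⟩ := Link.mem_components.1 h
  cases h

theorem mem_syms_of_root {α V : Type*} {rk : α → ℕ} {t : RTerm rk V} {a : α}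
    (h : t.root = some a) : a ∈ t.syms := by
  cases t with
  | var x => simp [RTerm.root] at h
  | node b ts =>
    obtain rfl : b = a := by simpa [RTerm.root] using h
    exact mem_syms_node.2 (.inl rfl)

theorem mem_syms_of_subterm {α V : Type*} {rk : α → ℕ} {s t : RTerm rk V} (h : Subterm s t)
    {a : α} (ha : a ∈ s.syms) : a ∈ t.syms := by
  induction h with
  | refl => exact ha
  | child i _ ih => exact mem_syms_node.2 (.inr ⟨i, ih⟩)

/-- Since the links are realized, the class of `x` is seen at the root of an actual tree of the
language. This is why rules are admitted only for realized links. -/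
theorem mem_rootLabels_of_start {ρ : G.R} {ps : Fin (G.ruleRank ρ) → G.Link} (hr : Realized ρ ps)
    (hs : ρ.1.lhs = [G.start]) {x : G.Component} (hx : (next ρ ps).all = [x])
    (ht : ∀ g : G.Component → RTerm rk ℕ, subst g ((next ρ ps).tree G.start) = g x) :
    (Fintype.equivFin T).symm (G.symbolClass (.inl x)) ∈ G.rootLabels := by
  obtain ⟨d, hd, hl⟩ := hr.exists_der
  obtain ⟨f, g, hv, hi⟩ := hd.exists_interp
  rw [hs] at hd hv
  obtain ⟨t, htG, htv⟩ := hd.exists_tree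
  rw [hl] at hi
  have h₁ : f G.start = g x := by
    rw [← hi.tree_eq G.start (by change _ ∈ ρ.1.lhs; simp [hs]), ht]
  obtain ⟨σ, h₂, h₃⟩ := hi.root x (by simp [hx])
  refine ⟨t, htG, ?_⟩
  rw [← h₃, Equiv.symm_apply_apply, ← h₂, ← h₁, ← root_toPattern]
  rw [hv] at htv
  simp only [List.map_cons, List.map_nil, List.cons.injEq, and_true] at htv
  rw [htv]

variable (G)

theorem newGrammar_isMCTAG (hG : RootConsistent G.treeLanguage) : G.newGrammar.IsMCTAG := by
  have hzip : ∀ (l : List G.Component) (f : G.Component → RTerm G.symbolRank ℕ),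
      ∀ p ∈ l.zip (l.map f), p.1 ∈ l ∧ p.2 = f p.1 := by
    intro l f p hp
    induction l with
    | nil => simp at hp
    | cons a l ih =>
      simp only [List.map_cons, List.zip_cons_cons, List.mem_cons] at hp
      rcases hp with rfl | hp
      · simp
      · exact ⟨List.mem_cons_of_mem _ (ih hp).1, (ih hp).2⟩
  refine ⟨?_, ⟨⟨fun a b => G.symbolKey a = G.symbolKey b, fun _ => rfl, Eq.symm, Eq.trans⟩,
    ?_, ?_, ?_⟩⟩
  · intro r hr p hpz
    obtain ⟨ρ, ps, b, ha, rfl⟩ := G.mem_newGrammar_rules.1 hr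
    have hp := ha.realized.fits
    cases b
    · obtain ⟨hx, he⟩ := hzip _ _ p hpz
      obtain ⟨C, hC, ℓ, hℓ, e⟩ := mem_next_all hx
      rw [he, e]
      rcases (piece_isPiece hp hC hℓ).foot with h | ⟨a, h, -⟩
      exacts [.inl h, .inr ⟨a, h⟩]
    · have : p.1 ∈ [none] := (List.of_mem_zip hpz).1
      exact .inl (by rw [List.mem_singleton.1 this]; rfl)
  · intro σ τ hne h
    have h : G.symbolKey (.inr σ) = G.symbolKey (.inr τ) := h
    rw [symbolKey_inr, symbolKey_inr, collapse, collapse] at h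
    split_ifs at h with h₁ h₂ h₂
    -- Two distinct terminals are identified only if both are root labels, which is where root
    -- consistency enters.
    · obtain ⟨t₁, ht₁, hr₁⟩ := h₁
      obtain ⟨t₂, ht₂, hr₂⟩ := h₂
      exact hG t₁ ht₁ t₂ ht₂ σ τ hr₁ hr₂ hne
    · exact (hne (Option.some.inj h)).elim
  · intro x
    change ∃ σ, G.symbolKey (.inl x) = G.symbolKey (.inr σ)
    by_cases h : (.inl x : G.Component ⊕ T) = .inl none ∧ G.rootLabels.Nonempty
    · obtain ⟨σ, hσ⟩ := h.2
      exact ⟨σ, by rw [symbolKey, if_pos h, symbolKey_inr, collapse, if_pos hσ]⟩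
    · exact ⟨_, by rw [symbolKey, if_neg h, symbolKey_inr]⟩
  · intro r hr p hpz
    obtain ⟨ρ, ps, b, ha, rfl⟩ := G.mem_newGrammar_rules.1 hr
    have hp := ha.realized.fits
    cases b
    · obtain ⟨hx, he⟩ := hzip _ _ p hpz
      obtain ⟨x, w⟩ := p
      dsimp only at hx he ⊢
      subst he
      obtain ⟨C, hC, ℓ, hℓ, e⟩ := mem_next_all hx
      have hpc := piece_isPiece hp hC hℓ
      rw [← e] at hpc
      have hkey : ∀ a ∈ (piece ρ ps x).syms, G.symbolClass a = ℓ.2.1 →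
          G.symbolKey a = G.symbolKey (.inl x) := by
        intro a ha hcl
        rw [symbolKey_eq (ne_none_of_mem_piece hp hx ha), symbolKey_eq (by simp [e]), hcl, e]
        rfl
      refine ⟨?_, fun hk a hfa => ?_⟩
      · obtain ⟨a, h₁, h₂⟩ := hpc.root
        exact ⟨a, h₁, hkey a (mem_syms_of_root h₁) h₂⟩
      · have hrank : G.newGrammar.rkN x = labelRank rk ℓ.2 := by rw [e]; rfl
        rw [hrank] at hk hfa
        rcases hpc.foot with h | ⟨b, hb, hcl⟩
        · exact absurd hk (by rw [labelRank, h]; exact Nat.not_succ_le_zero 0)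
        -- The definition speaks of every foot label, the decomposition provides one of the right
        -- class; they coincide.
        · obtain rfl := IsFootLabel.unique hpc.isPattern hk hfa hb
          exact hkey _ (mem_syms_of_subterm hb.2 (mem_syms_node.2 (.inl rfl))) hcl
    · obtain ⟨x, hx, h0, ht⟩ := all_eq_of_start hp (ha.initial rfl)
      have hroot := mem_rootLabels_of_start ha.realized (ha.initial rfl) hx ht
      have hxm : x ∈ (next ρ ps).all := by simp [hx]
      simp only [newRule, newRhs, hx, if_true, List.map_cons, List.map_nil] at hpz
      obtain rfl : p = (none, piece ρ ps x) := List.mem_singleton.1 hpz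
      refine ⟨?_, fun h => absurd h (Nat.not_succ_le_zero 0)⟩
      obtain ⟨C, hC, ℓ, hℓ, e⟩ := mem_next_all hxm
      have hpc := piece_isPiece hp hC hℓ
      rw [← e] at hpc
      obtain ⟨a, h₁, h₂⟩ := hpc.root
      refine ⟨a, h₁, ?_⟩
      change G.symbolKey a = G.symbolKey (.inl none)
      have hcl : G.symbolClass a = G.symbolClass (.inl x) := by rw [h₂, e]; rfl
      rw [symbolKey_eq (ne_none_of_mem_piece hp hxm (mem_syms_of_root h₁)), hcl, collapse,
        if_pos hroot, symbolKey, if_pos ⟨rfl, _, hroot⟩]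

end MCFTG

end TreeGrammar

namespace TreeGrammar

open RTerm

theorem flatten_ofFn_singleton {γ : Type*} {n : ℕ} (f : Fin n → γ) :
    (List.ofFn fun i => [f i]).flatten = List.ofFn f := by
  conv_rhs => rw [← List.flatMap_singleton' (List.ofFn f), List.flatMap_def, List.map_ofFn]
  rfl

theorem isRegular_univ {Ω : Type*} {rk : Ω → ℕ} : IsRegular (Set.univ : Set (RTree rk)) := by
  refine ⟨⟨Unit, inferInstance, (), fun _ _ _ => True⟩, Set.eq_univ_of_forall fun t => ?_⟩
  change RTG.Gen _ _ t
  induction t with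
  | var e => exact e.elim
  | node a ts ih => exact RTG.gen_node.2 ⟨fun _ => (), trivial, ih⟩

namespace MCFTG

variable {T : Type*} [Fintype T] {rk : T → ℕ} (G : MCFTG rk)

/-! ## From `G` to the new grammar -/

/-- The derivation trees with given shapes. -/
def treesOf (p : G.Link) : Set (RTree G.ruleRank) := {d | G.Der p.1.1 d ∧ linkOfTree d = p}

/-- The shapes are computed bottom-up by a finite-state device; read top-down, its states are the
nonterminals of a regular tree grammar. -/
theorem isRegular_treesOf (p : G.Link) : IsRegular (G.treesOf p) := by
  let H : RTG G.ruleRank :=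
    ⟨G.Link, inferInstance, p, fun q ρ qs => q = next ρ qs ∧
      ∀ i, (qs i).1.1 = ρ.1.links.get i⟩
  have h : ∀ (d : RTree G.ruleRank) (q : G.Link), H.Gen q d ↔ G.Der q.1.1 d ∧ linkOfTree d = q := by
    intro d
    induction d with
    | var e => exact e.elim
    | node ρ ds ih =>
      intro q
      rw [RTG.gen_node, G.der_node]
      constructor
      · rintro ⟨qs, ⟨rfl, h₁⟩, h₂⟩
        have h₃ := fun i => (ih i (qs i)).1 (h₂ i)
        refine ⟨⟨rfl, fun i => h₁ i ▸ (h₃ i).1⟩, ?_⟩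
        simp only [linkOfTree, (h₃ _).2]
      · rintro ⟨⟨h₁, h₂⟩, rfl⟩
        have h₃ := fun i => (h₂ i).linkOfTree.1
        exact ⟨fun i => linkOfTree (ds i), ⟨rfl, h₃⟩, fun i => (ih i _).2
          ⟨by rw [h₃]; exact h₂ i, rfl⟩⟩
  exact ⟨H, Set.ext fun d => h d p⟩

variable {G}

theorem exists_source {ρ : G.R} {ps : Fin (G.ruleRank ρ) → G.Link}
    (j : Fin (newLinks ρ ps).length) : ∃ i, (ps i).all = (newLinks ρ ps).get j :=
  (mem_newLinks.1 (List.get_mem _ j)).2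

/-- The position of the link of `ρ` that corresponds to a link of the new rule. -/
noncomputable def source {ρ : G.R} {ps : Fin (G.ruleRank ρ) → G.Link}
    (j : Fin (newLinks ρ ps).length) : Fin (G.ruleRank ρ) := (exists_source j).choose

theorem all_source {ρ : G.R} {ps : Fin (G.ruleRank ρ) → G.Link}
    (j : Fin (newLinks ρ ps).length) : (ps (source j)).all = (newLinks ρ ps).get j :=
  (exists_source j).choose_spec

theorem newLinks_nodup {ρ : G.R} {ps : Fin (G.ruleRank ρ) → G.Link} : (newLinks ρ ps).Nodup :=
  Finset.nodup_toList _

theorem source_injective {ρ : G.R} {ps : Fin (G.ruleRank ρ) → G.Link} :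
    Function.Injective (source (ρ := ρ) (ps := ps)) := by
  intro j j' h
  have := all_source j
  rw [h, all_source j'] at this
  exact ((newLinks_nodup.get_inj_iff).1 this).symm

/-- The new rule, as a symbol of the alphabet of rules. -/
noncomputable def newSymbol {ρ : G.R} {ps : Fin (G.ruleRank ρ) → G.Link} {b : Bool}
    (h : Admissible ρ ps b) : G.newGrammar.R :=
  ⟨newRule ρ ps b, G.mem_newGrammar_rules.2 ⟨ρ, ps, b, h, rfl⟩⟩

/-- The state tells whether the new rule is the initial copy, which is used only at the root; all
calls therefore have state `false`. The look-ahead sets for different `ps` are disjoint, as a tree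
has only one family of shapes. -/
noncomputable def forwardRule {ρ : G.R} {b : Bool}
    (ps : {ps : Fin (G.ruleRank ρ) → G.Link // Admissible ρ ps b}) :
    LDTRRule Bool G.ruleRank G.newGrammar.ruleRank (G.ruleRank ρ) where
  look₀ := Set.univ
  look i := G.treesOf (ps.1 i)
  rhs := node (newSymbol ps.2) fun j => var (false, source (ρ := ρ) (ps := ps.1) j)

variable (G)

/-- The transducer that translates derivation trees of `G` into those of the new grammar. -/
noncomputable def forward : LDTR G.ruleRank G.newGrammar.ruleRank where
  State := Bool
  finite_State := inferInstance
  init := true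
  rules b ρ := Set.range (forwardRule (ρ := ρ) (b := b))
  finite_rules _ _ := Set.finite_range _
  regular₀ := by
    rintro b ρ _ ⟨ps, rfl⟩
    exact isRegular_univ
  regular := by
    rintro b ρ _ ⟨ps, rfl⟩ i
    exact G.isRegular_treesOf _
  linear := by
    rintro b ρ _ ⟨ps, rfl⟩
    have h : (forwardRule ps).rhs.vars =
        List.ofFn fun j => (false, source (ρ := ρ) (ps := ps.1) j) := by
      simp only [forwardRule, vars]
      exact flatten_ofFn_singleton _
    rw [h, List.map_ofFn, List.nodup_ofFn]
    exact source_injective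
  deterministic := by
    rintro b ρ _ ⟨ps, rfl⟩ _ ⟨ps', rfl⟩ hne
    have : ∃ i, ps.1 i ≠ ps'.1 i := by
      by_contra! h
      exact hne (congrArg _ (Subtype.ext (funext h)))
    obtain ⟨i, hi⟩ := this
    refine .inr ⟨i, Set.disjoint_left.2 fun d hd hd' => hi ?_⟩
    exact hd.2.symm.trans hd'.2

variable {G}

/-- The interpretations are claimed outside the condition on components: a subtree without
components has no translation, but its value still enters the parent's. -/
theorem Der.forward {A : List G.NT} {d : RTree G.ruleRank} (h : G.Der A d) :
    ∃ f g, G.val d = A.map f ∧ Interp (MCFTG.linkOfTree d) f g ∧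
      ∀ b : Bool, (b = true → A = [G.start]) → (b = false → ¬ (G.StartSeparated ∧ A = [G.start])) →
        (MCFTG.linkOfTree d).all ≠ [] →
        ∃ d', G.forward.Trans b d d' ∧
          G.newGrammar.Der (if b then [none] else (MCFTG.linkOfTree d).all) d' ∧
          G.newGrammar.val d' = (MCFTG.linkOfTree d).all.map g := by
  induction d generalizing A with
  | var e => exact e.elim
  | node ρ ds ih =>
    have hr := h.realized
    obtain ⟨rfl, hd⟩ := G.der_node.1 h
    choose fs gs hv hi htr using fun i => ih i (hd i)
    obtain ⟨f, g, hf, hg, hfg⟩ := Interp.glue hr.fits hi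
    refine ⟨_, _, ?_, Interp.next hr.fits hfg, fun b hb hb' hne => ?_⟩
    · rw [G.val_node (f := f) fun i =>
        (hv i).trans (List.map_congr_left fun C hC => (hf i C hC).symm),
        ← G.map_rhsOf ρ, List.map_map]
      rfl
    set ps : Fin (G.ruleRank ρ) → G.Link := fun i => MCFTG.linkOfTree (ds i) with hps
    have hadm : Admissible ρ ps b := ⟨hr, hb, hne, hb'⟩
    have hch : ∀ j : Fin (newLinks ρ ps).length, ∃ d',
        G.forward.Trans false (ds (source j)) d' ∧
          G.newGrammar.Der ((newLinks ρ ps).get j) d' ∧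
          G.newGrammar.val d' = ((newLinks ρ ps).get j).map g := by
      intro j
      have hall := all_source j
      have hne : (ps (source j)).all ≠ [] := by
        rw [hall]
        exact (mem_newLinks.1 (List.get_mem _ j)).1
      -- If `G` is start-separated, the initial nonterminal is not in a link, so noninitial copies
      -- exist for all children.
      obtain ⟨d', h₁, h₂, h₃⟩ := htr (source j) false (by simp) (fun _ hs => by
        refine hs.1 ρ.1 ρ.2 ((G.mem_links _ ρ.2 _).1 (mem_flatten_iff_get.2 ⟨source j, ?_⟩))
        rw [hs.2]
        simp) hne
      refine ⟨d', h₁, hall ▸ h₂, ?_⟩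
      rw [h₃, ← hall]
      exact List.map_congr_left fun x hx => (hg _ x hx).symm
    choose ds' htr' hder' hval' using hch
    have hnonempty : Nonempty (RTree G.newGrammar.ruleRank) :=
      ⟨node (newSymbol hadm) fun j => ds' j⟩
    -- A translation must be named for every child, also for those deleted by the rule; there any
    -- tree serves.
    obtain ⟨inv, hinv⟩ : ∃ inv : Fin (G.ruleRank ρ) → RTree G.newGrammar.ruleRank,
        ∀ j, inv (source j) = ds' j :=
      ⟨Function.extend source ds' fun _ => hnonempty.some, fun j =>
        source_injective.extend_apply _ _ _⟩
    refine ⟨node (newSymbol hadm) fun j => ds' j, ?_, ?_, ?_⟩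
    · have hmem : forwardRule ⟨ps, hadm⟩ ∈ G.forward.rules b ρ := ⟨_, rfl⟩
      have ht := LDTR.Trans.mk (M := G.forward) b ρ ds _ (fun x => inv x.2) hmem
        (Set.mem_univ _) (fun i => ⟨by rw [(hd i).linkOfTree.1]; exact hd i, rfl⟩) (by
          intro x hx
          simp only [forwardRule] at hx
          obtain ⟨j, hj⟩ := mem_vars_node.1 hx
          obtain rfl : x = (false, source j) := List.mem_singleton.1 hj
          change G.forward.Trans false (ds (source j)) (inv (source j))
          exact (congrArg (G.forward.Trans false (ds (source j))) (hinv j)).mpr (htr' j))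
      have he : (forwardRule ⟨ps, hadm⟩).rhs.bind (fun x => inv x.2) =
          node (newSymbol hadm) fun j => ds' j := by
        simp only [forwardRule, RTerm.bind]
        congr 1
        funext j
        exact hinv j
      exact he ▸ ht
    · exact G.newGrammar.der_node.2 ⟨rfl, hder'⟩
    · rw [G.newGrammar.val_node (f := g) (ρ := newSymbol hadm) hval']
      change (newRhs ρ ps).map (subst g) = _
      rw [newRhs, List.map_map]
      rfl

theorem val_eq_of_start {d : RTree G.ruleRank} (h : G.Der [G.start] d)
    {f : G.NT → RTerm rk ℕ} {g : G.Component → RTerm rk ℕ} (hv : G.val d = [G.start].map f)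
    (hi : Interp (linkOfTree d) f g) :
    (linkOfTree d).all ≠ [] ∧ (linkOfTree d).all.map g = G.val d := by
  have h₁ := h.linkOfTree
  have hmem : G.start ∈ (linkOfTree d).1.1 := by simp [h₁.1]
  obtain ⟨x, h₂, -, h₃⟩ := h₁.2.rank_zero hmem G.start_rank
  have hall : (linkOfTree d).all = [x] := by simp [Link.all, h₁.1, h₂]
  rw [hall, hv]
  refine ⟨by simp, ?_⟩
  rw [List.map_singleton, List.map_singleton, ← hi.tree_eq _ hmem, h₃]

/-! ## From the new grammar to `G` -/

/-- A rule of `G` with shapes from which a new rule originates. -/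
structure Origin (r : G.newGrammar.R) where
  rule : G.R
  links : Fin (G.ruleRank rule) → G.Link
  initial : Bool
  admissible : Admissible rule links initial
  eq : newRule rule links initial = r.1

/-- A new rule may have several origins. Any choice works, as only the value has to be preserved. -/
noncomputable def origin (r : G.newGrammar.R) : Origin r :=
  have h := G.mem_newGrammar_rules.1 r.2
  ⟨h.choose, h.choose_spec.choose, h.choose_spec.choose_spec.choose,
    h.choose_spec.choose_spec.choose_spec.1, h.choose_spec.choose_spec.choose_spec.2⟩

/-- The derivation trees that are inserted for links without components. -/
noncomputable def Origin.filler {r : G.newGrammar.R} (o : Origin r) (i : Fin (G.ruleRank o.rule)) :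
    RTree G.ruleRank :=
  (o.admissible.realized i).choose

theorem Origin.filler_spec {r : G.newGrammar.R} (o : Origin r) (i : Fin (G.ruleRank o.rule)) :
    G.Der (o.rule.1.links.get i) (o.filler i) ∧ linkOfTree (o.filler i) = o.links i :=
  (o.admissible.realized i).choose_spec

theorem Origin.mem_links {r : G.newGrammar.R} (o : Origin r) {B : List G.Component} :
    B ∈ r.1.links ↔ B ≠ [] ∧ ∃ i, (o.links i).all = B := by
  rw [← o.eq]
  exact mem_newLinks

-- A link without a counterpart has no components, so its shapes are bare variables. Its value is
-- then fixed by the shapes, and any derivation tree with these shapes can be inserted.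
open Classical in
noncomputable def Origin.rhs {r : G.newGrammar.R} (o : Origin r) :
    RTerm G.ruleRank (Unit × Fin (G.newGrammar.ruleRank r)) :=
  node o.rule fun i =>
    if h : ∃ j, r.1.links.get j = (o.links i).all then var ((), h.choose)
    else (o.filler i).bind Empty.elim

theorem vars_bind_elim {α V : Type*} {rk : α → ℕ} (t : RTree rk) :
    (t.bind (Empty.elim : Empty → RTerm rk V)).vars = [] := by
  rw [vars_bind, List.flatMap_eq_nil_iff]
  exact fun e _ => e.elim

theorem bind_elim_bind {α V : Type*} {rk : α → ℕ} (t : RTree rk) (g : V → RTree rk) :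
    (t.bind (Empty.elim : Empty → RTerm rk V)).bind g = t := by
  rw [bind_bind]
  exact bind_eq_self fun e _ => e.elim

theorem Origin.links_eq {r : G.newGrammar.R} (o : Origin r) {j : Fin (G.newGrammar.ruleRank r)}
    {i i' : Fin (G.ruleRank o.rule)} (h : r.1.links.get j = (o.links i).all)
    (h' : r.1.links.get j = (o.links i').all) : i = i' := by
  obtain ⟨x, hx⟩ := List.exists_mem_of_ne_nil _ (o.mem_links.1 (List.get_mem r.1.links j)).1
  exact o.admissible.realized.fits.eq_of_mem_all (h ▸ hx) (h' ▸ hx)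

theorem Origin.rhs_linear {r : G.newGrammar.R} (o : Origin r) :
    (o.rhs.vars.map Prod.snd).Nodup := by
  classical
  simp only [Origin.rhs, vars, List.map_flatten, List.map_ofFn, Function.comp_def]
  have hcases : ∀ (i : Fin (G.ruleRank o.rule)) (j : Fin (G.newGrammar.ruleRank r)),
      j ∈ ((if h : ∃ j, r.1.links.get j = (o.links i).all then var ((), h.choose)
        else (o.filler i).bind Empty.elim :
        RTerm G.ruleRank (Unit × Fin (G.newGrammar.ruleRank r))).vars.map Prod.snd) →
      r.1.links.get j = (o.links i).all := by
    intro i j hj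
    split_ifs at hj with h
    · simp only [vars, List.map_cons, List.map_nil, List.mem_singleton] at hj
      rw [hj]
      exact h.choose_spec
    · rw [vars_bind_elim] at hj
      simp at hj
  rw [List.nodup_flatten]
  constructor
  · intro l hl
    obtain ⟨i, rfl⟩ := List.mem_ofFn.1 hl
    split_ifs with h
    · simp [vars]
    · simp [vars_bind_elim]
  · rw [List.pairwise_ofFn]
    intro i i' hii j hj hj'
    exact hii.ne (o.links_eq (hcases i j hj) (hcases i' j hj'))

variable (G)

/-- The transducer that translates derivation trees of the new grammar into those of `G`. -/
noncomputable def backward : LDTR G.newGrammar.ruleRank G.ruleRank where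
  State := Unit
  finite_State := inferInstance
  init := ()
  rules _ r := {⟨Set.univ, fun _ => Set.univ, (origin r).rhs⟩}
  finite_rules _ _ := Set.finite_singleton _
  regular₀ := by
    rintro _ r _ rfl
    exact isRegular_univ
  regular := by
    rintro _ r _ rfl _
    exact isRegular_univ
  linear := by
    rintro _ r _ rfl
    exact (origin r).rhs_linear
  deterministic := by
    rintro _ r _ rfl _ rfl h
    exact (h rfl).elim

variable {G}

/-- The shapes of the translated tree agree with those in the names of the components, so the pieces
generated by the new tree assemble to the value of the old one. -/
theorem Der.backward {A : List G.Component} {d' : RTree G.newGrammar.ruleRank}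
    (h : G.newGrammar.Der A d') :
    ∃ (d : RTree G.ruleRank) (b : Bool) (f : G.NT → RTerm rk ℕ) (g : G.Component → RTerm rk ℕ),
      G.backward.Trans () d' d ∧ G.Der (MCFTG.linkOfTree d).1.1 d ∧
      A = (if b then [none] else (MCFTG.linkOfTree d).all) ∧
      (b = true → (MCFTG.linkOfTree d).1.1 = [G.start]) ∧
      G.val d = (MCFTG.linkOfTree d).1.1.map f ∧ Interp (MCFTG.linkOfTree d) f g ∧
      G.newGrammar.val d' = (MCFTG.linkOfTree d).all.map g := by
  classical
  induction d' generalizing A with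
  | var e => exact e.elim
  | node r ds' ih =>
    obtain ⟨rfl, hd'⟩ := G.newGrammar.der_node.1 h
    choose ds bs fs gs htr hder hA hb hv hi hval using fun j => ih j (hd' j)
    set o := origin r with ho
    have hp := o.admissible.realized.fits
    -- A link of `r` is nonempty, and any component in it names the shapes; it cannot be `[none]`,
    -- since `none` is in no list of components.
    have hlink : ∀ j i, r.1.links.get j = (o.links i).all → MCFTG.linkOfTree (ds j) = o.links i := by
      intro j i hji
      have hj := hA j
      rw [hji] at hj
      obtain ⟨x, hx⟩ :=
        List.exists_mem_of_ne_nil _ (o.mem_links.1 (List.get_mem r.1.links j)).1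
      rw [hji] at hx
      cases hbj : bs j
      · rw [hbj] at hj
        have hj : (o.links i).all = (MCFTG.linkOfTree (ds j)).all := hj
        exact Link.eq_of_mem_all (by rw [← hj]; exact hx) hx
      · rw [hbj] at hj
        have : none ∈ (o.links i).all := by rw [hj]; simp
        exact ((o.links i).none_notMem_all this).elim
    let es : Fin (G.ruleRank o.rule) → RTree G.ruleRank := fun i =>
      if h : ∃ j, r.1.links.get j = (o.links i).all then ds h.choose else o.filler i
    have hes : ∀ i, ∃ f g, G.Der (o.rule.1.links.get i) (es i) ∧
        MCFTG.linkOfTree (es i) = o.links i ∧ G.val (es i) = (o.rule.1.links.get i).map f ∧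
        Interp (o.links i) f g ∧ ∀ j, r.1.links.get j = (o.links i).all →
          G.newGrammar.val (ds' j) = (r.1.links.get j).map g := by
      intro i
      by_cases hj : ∃ j, r.1.links.get j = (o.links i).all
      · obtain ⟨j₀, hj₀, he⟩ : ∃ j, r.1.links.get j = (o.links i).all ∧ es i = ds j :=
          ⟨hj.choose, hj.choose_spec, dif_pos hj⟩
        have hl := hlink j₀ i hj₀
        refine ⟨fs j₀, gs j₀, ?_, ?_, ?_, ?_, fun j hj' => ?_⟩
        · rw [he, ← (hp i).1, ← hl]
          exact hder _
        · rw [he, hl]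
        · rw [he, ← (hp i).1, ← hl]
          exact hv _
        · rw [← hl]
          exact hi _
        · have hnd : r.1.links.Nodup := by
            rw [← o.eq]
            exact newLinks_nodup
          obtain rfl : j = j₀ := hnd.get_inj_iff.1 (hj'.trans hj₀.symm)
          rw [hval, hl, hj']
      · have he : es i = o.filler i := dif_neg hj
        obtain ⟨h₁, h₂⟩ := o.filler_spec i
        obtain ⟨f, g, h₃, h₄⟩ := h₁.exists_interp
        exact ⟨f, g, by rwa [he], by rw [he, h₂], by rw [he, h₃], h₂ ▸ h₄,
          fun j hj' => (hj ⟨j, hj'⟩).elim⟩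
    choose fs' gs' hder' hl' hv' hi' hval' using hes
    obtain ⟨f, g, hf, hg, hfg⟩ := Interp.glue hp hi'
    have hlt : MCFTG.linkOfTree (node o.rule es) = next o.rule o.links := by
      simp only [MCFTG.linkOfTree, hl']
    have hderd : G.Der o.rule.1.lhs (node o.rule es) := G.der_node.2 ⟨rfl, hder'⟩
    refine ⟨node o.rule es, o.initial, fun C => subst f (G.rhsOf o.rule C),
      fun x => subst g (piece o.rule o.links x), ?_, hderd, ?_, ?_, ?_, ?_, ?_⟩
    · have ht := LDTR.Trans.mk (M := G.backward) () r ds' _ (fun x => ds x.2) rfl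
        (Set.mem_univ _) (fun i => Set.mem_univ _) fun x _ => htr x.2
      have he : o.rhs.bind (fun x => ds x.2) = node o.rule es := by
        simp only [Origin.rhs, RTerm.bind, es]
        congr 1
        funext i
        split_ifs with hj
        · rfl
        · exact bind_elim_bind _ _
      exact he ▸ ht
    · rw [hlt, ← o.eq]
      rfl
    · exact o.admissible.initial
    · rw [G.val_node (f := f) fun i =>
        (hv' i).trans (List.map_congr_left fun C hC => (hf i C hC).symm),
        ← G.map_rhsOf o.rule, List.map_map]
      rfl
    · rw [hlt]
      exact Interp.next hp hfg
    · rw [G.newGrammar.val_node (f := g) fun j => ?_]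
      · rw [hlt, ← o.eq]
        change (newRhs o.rule o.links).map (subst g) = _
        rw [newRhs, List.map_map]
        rfl
      · obtain ⟨-, i, hij⟩ := o.mem_links.1 (List.get_mem r.1.links j)
        rw [hval' i j hij.symm]
        refine List.map_congr_left fun x hx => (hg i x ?_).symm
        rw [hij]
        exact hx

variable (G)

theorem newGrammar_equivalent : LDTREquivalent G G.newGrammar := by
  refine ⟨⟨G.forward, fun d hd => ?_⟩, ⟨G.backward, fun d' hd' => ?_⟩⟩
  · have hd := G.mem_language_iff.1 hd
    obtain ⟨f, g, hv, hi, h⟩ := hd.forward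
    obtain ⟨hne, he⟩ := val_eq_of_start hd hv hi
    obtain ⟨d', h₁, h₂, h₃⟩ := h true (fun _ => rfl) (by simp) hne
    exact ⟨d', h₁, G.newGrammar.mem_language_iff.2 h₂, h₃.trans he⟩
  · have hd' := G.newGrammar.mem_language_iff.1 hd'
    obtain ⟨d, b, f, g, h₁, h₂, h₃, h₄, h₅, h₆, h₇⟩ := Der.backward hd'
    have h₃ : [none] = if b then [none] else (linkOfTree d).all := h₃
    cases b
    · have : none ∈ (linkOfTree d).all := by
        have h₃ : [none] = (linkOfTree d).all := h₃
        rw [← h₃]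
        simp
      exact ((linkOfTree d).none_notMem_all this).elim
    · rw [h₄ rfl] at h₂ h₅
      exact ⟨d, h₁, G.mem_language_iff.2 h₂, (h₇.trans (val_eq_of_start h₂ h₅ h₆).2).symm⟩

end MCFTG

end TreeGrammar

/-! ### The main theorem. -/

theorem mainTheorem4 {T : Type*} [Fintype T] (rk : T → ℕ) (G : TreeGrammar.MCFTG rk)
    (hG : TreeGrammar.RootConsistent G.treeLanguage) :
    ∃ G' : TreeGrammar.MCFTG rk,
      G'.IsMCTAG ∧ G'.StartSeparated ∧
      TreeGrammar.MCFTG.LDTREquivalent G G' ∧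
      (G.width = 0 → G'.multiplicity ≤ G.multiplicity) ∧
      (1 ≤ G.width → G'.multiplicity ≤
        G.multiplicity * Fintype.card T * (Finset.univ.sup rk) ^ 2 * (2 * G.width - 1)) ∧
      (G.StartSeparated → ∀ Δ : Set T, G.IsLexicalized Δ → G'.IsLexicalized Δ) := by
  have hμ := G.newGrammar_multiplicity_le
  refine ⟨G.newGrammar, G.newGrammar_isMCTAG hG, G.newGrammar_startSeparated,
    G.newGrammar_equivalent, fun hw => ?_, fun hw => ?_,
    fun hs Δ => G.newGrammar_isLexicalized hs⟩
  · simpa [hw, TreeGrammar.MCFTG.shapeBound] using hμ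
  · obtain ⟨σ, hσ⟩ := G.exists_pos_rank
    have h₁ : 1 ≤ Finset.univ.sup rk := hσ.trans (Finset.le_sup (f := rk) (Finset.mem_univ σ))
    refine hμ.trans ?_
    rw [TreeGrammar.MCFTG.shapeBound, if_neg (by omega)]
    -- The construction needs only the first power of the maximal rank; the stated bound is weaker.
    have h₂ : Finset.univ.sup rk ≤ (Finset.univ.sup rk) ^ 2 := Nat.le_self_pow two_ne_zero _
    calc G.multiplicity * (Finset.univ.sup rk * Fintype.card T * (2 * G.width - 1))
        = G.multiplicity * Fintype.card T * Finset.univ.sup rk * (2 * G.width - 1) := by ring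
      _ ≤ _ := by gcongr
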